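/- Let $d\ge 2$, and let $\nu=(p_1/q,\dots,p_d/q)$ with positive integers $p_1,\dots,p_d,q$ such that $p_i<q$ for all $i$ and $\gcd(p_1,\dots,p_d,q)=1$. Let $L_\nu=\mathbb Z^d+\mathbb Z\nu\subset\mathbb R^d$, and let $\tau(L_\nu)=\inf\{\sigma>0: L_\nu+\sigma B=\mathbb R^d\}$ be its covering radius, where $B$ is the Euclidean unit ball. For $x\in\mathbb R^d$ put $N(x)=\|(x_1,\dots,x_{d-1},1-x_d)\|$ (Euclidean norm), let $x \bmod 1$ be the vector of fractional parts $(\{x_1\},\dots,\{x_d\})$, and let $$m_{add}(\nu)=\min\{N(t\nu \bmod 1):\ t=1,\dots,q-1,\ \{t\nu_d\}>0\}.$$ For a rational $\delta\in(0,1)$, let $\xi_{add}(\nu,\delta)$ be the output of the following algorithm. Put $\epsilon=\delta/\lceil\sqrt d\,\rceil$, $c(r)=(r,\dots,r,1-r)\in\mathbb R^d$ and $\mathcal S=[0,\infty)^{d-1}\times(-\infty,1)$. Compute a basis $u_1,\dots,u_d$ of $L_\nu$ (any basis is allowed). Set $r^-:=0$, $r^+:=1$, $\xi:=c(1)$. While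 $r^+-r^->\epsilon$: let $r=(r^-+r^+)/2$, let $\chi\in L_\nu$ be the vector that Babai's nearest plane algorithm (LLL reduction of $u_1,\dots,u_d$ with parameter $3/4$, followed by nearest plane rounding) returns for the target point $c(r)$; if $\chi\in\mathcal S$, set $r^+:=r$ and $\xi:=\chi$, otherwise set $r^-:=r$. When the loop ends, output $\xi \bmod 1$ if $\xi\notin\mathbb Z^d$, and output $\nu$ if $\xi\in\mathbb Z^d$. Then, for every choice of the basis $u_1,\dots,u_d$, the algorithm terminates, and its output for $\delta=1/q$ satisfies $$\frac{N(\xi_{add}(\nu,1/q))}{m_{add}(\nu)}<2^{3d/2-1}(1+\sqrt d)\,\tau(L_\nu)^d\,q+1 .$$ Consequently the approximation factor is $2^{O(d)}$ when $\tau(L_\nu)\ll q^{-1/d}$: for every $C>0$ there is $K>0$, depending only on $C$, such that for all $d\ge2$, all $\nu$ as above with $\tau(L_\nu)\le C q^{-1/d}$, and every choice of the basis, $$\frac{N(\xi_{add}(\nu,1/q))}{m_{add}(\nu)}<2^{Kd}.$$ -/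

import Mathlib

open scoped Pointwise

namespace CGCut

/-- Euclidean `d`-space. -/
abbrev E (d : ℕ) : Type := EuclideanSpace ℝ (Fin d)

/-- A rational vector, regarded as a vector of Euclidean space. -/
noncomputable def toReal {d : ℕ} (x : Fin d → ℚ) : E d :=
  WithLp.toLp 2 (fun i => (x i : ℝ))

/-! ### Input vectors, the lattice, the covering radius -/

/-- The integers `p 0, …, p (d - 1), q` are admissible: they are positive, every `p i` is less
than `q`, and `gcd (p 0, …, p (d - 1), q) = 1`. -/
def Admissible {d : ℕ} (p : Fin d → ℕ) (q : ℕ) : Prop :=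
  0 < q ∧ (∀ i, 0 < p i ∧ p i < q) ∧ Nat.gcd (Finset.univ.gcd p) q = 1

/-- The rational vector `(p 0 / q, …, p (d - 1) / q)`. -/
def nuVec {d : ℕ} (p : Fin d → ℕ) (q : ℕ) : Fin d → ℚ :=
  fun i => (p i : ℚ) / (q : ℚ)

/-- `x mod 1`, coordinate by coordinate. -/
def modOne {d : ℕ} (x : Fin d → ℚ) : Fin d → ℚ :=
  fun i => Int.fract (x i)

/-- The lattice `ℤ^d + ℤ ν`. -/
noncomputable def iterLattice {d : ℕ} (ν : Fin d → ℚ) : Submodule ℤ (E d) :=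
  Submodule.span ℤ (Set.range fun i : Fin d => (EuclideanSpace.single i (1 : ℝ) : E d)) ⊔
    Submodule.span ℤ {toReal ν}

/-- The rational vectors `u 0, …, u (d - 1)` form a basis of the lattice `L`. -/
def IsLatticeBasis {d : ℕ} (u : Fin d → Fin d → ℚ) (L : Submodule ℤ (E d)) : Prop :=
  LinearIndependent ℝ (fun i => toReal (u i)) ∧
    Submodule.span ℤ (Set.range fun i => toReal (u i)) = L

/-- The inhomogeneous minimum of `S` with respect to `L`. -/
noncomputable def inhomMin {d : ℕ} (S : Set (E d)) (L : Submodule ℤ (E d)) : ℝ :=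
  sInf {σ : ℝ | 0 < σ ∧
    (L : Set (E d)) + σ • S = (Submodule.span ℝ (L : Set (E d)) : Set (E d))}

/-- The covering radius of `L`: the inhomogeneous minimum of the unit ball of the real span. -/
noncomputable def coveringRadius {d : ℕ} (L : Submodule ℤ (E d)) : ℝ :=
  inhomMin (Metric.closedBall (0 : E d) 1 ∩
    (Submodule.span ℝ (L : Set (E d)) : Set (E d))) L

/-! ### The additive optimization problem
The last coordinate of a vector with index set `Fin d` is the one with `i + 1 = d`. -/

/-- `N (x) = ‖(x_1, …, x_{d-1}, 1 - x_d)‖`. -/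
noncomputable def N {d : ℕ} (x : Fin d → ℚ) : ℝ :=
  ‖toReal (fun i : Fin d => if (i : ℕ) + 1 = d then 1 - x i else x i)‖

/-- The values `N (t ν mod 1)` for `t = 1, …, q - 1` with positive rounding effect, that is,
with positive last coordinate `{t ν_d}`. -/
def feasibleValues {d : ℕ} (p : Fin d → ℕ) (q : ℕ) : Set ℝ :=
  {v | ∃ t : ℕ, 1 ≤ t ∧ t < q ∧
    (∀ i : Fin d, (i : ℕ) + 1 = d → 0 < modOne ((t : ℚ) • nuVec p q) i) ∧
    v = N (modOne ((t : ℚ) • nuVec p q))}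

/-- The minimum of the additive problem. -/
noncomputable def mAdd {d : ℕ} (p : Fin d → ℕ) (q : ℕ) : ℝ :=
  sInf (feasibleValues p q)

/-- For admissible data (and `d ≠ 0`) the infimum above is a minimum. -/
theorem isLeast_mAdd {d : ℕ} (hd : d ≠ 0) {p : Fin d → ℕ} {q : ℕ} (h : Admissible p q) :
    IsLeast (feasibleValues p q) (mAdd p q) := by
  have hfin : (feasibleValues p q).Finite := by
    refine ((Set.finite_lt_nat q).image
      (fun t : ℕ => N (modOne ((t : ℚ) • nuVec p q)))).subset ?_
    rintro v ⟨t, -, ht, -, rfl⟩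
    exact ⟨t, ht, rfl⟩
  have hne : (feasibleValues p q).Nonempty := by
    obtain ⟨hq, hp, -⟩ := h
    have h0 := hp ⟨0, Nat.pos_of_ne_zero hd⟩
    refine ⟨_, 1, le_rfl, by omega, ?_, rfl⟩
    intro i _
    have hqq : (0 : ℚ) < q := by exact_mod_cast hq
    have h1 : (0 : ℚ) < (p i : ℚ) / q := div_pos (by exact_mod_cast (hp i).1) hqq
    have h2 : (p i : ℚ) / q < 1 := (div_lt_one hqq).2 (by exact_mod_cast (hp i).2)
    simp only [modOne, nuVec, Nat.cast_one, one_smul]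
    rw [Int.fract_eq_self.2 ⟨h1.le, h2⟩]
    exact h1
  exact ⟨hne.csInf_mem hfin, fun v hv => csInf_le hfin.bddBelow hv⟩

/-! ### While loops -/

/-- `while cond s do s := step s`. The value is defined exactly if the loop terminates. -/
def whileLoop {σ : Type} (cond : σ → Prop) [DecidablePred cond] (step : σ → σ) (s : σ) : Part σ :=
  ⟨∃ n : ℕ, ¬ cond (step^[n] s), fun h => step^[Nat.find h] s⟩

/-! ### The LLL algorithm (with parameter 3/4), in exact rational arithmetic -/

/-- Gram–Schmidt orthogonalization (without normalization). -/
def gramSchmidt {d : ℕ} (b : Fin d → Fin d → ℚ) (i : Fin d) : Fin d → ℚ :=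
  b i - ∑ j : Finset.Iio i,
    (dotProduct (b i) (gramSchmidt b j.1) /
      dotProduct (gramSchmidt b j.1) (gramSchmidt b j.1)) • gramSchmidt b j.1
termination_by i
decreasing_by
  have h := Finset.mem_Iio.1 j.2
  exact h

/-- The squared length of the `i`-th Gram–Schmidt vector. -/
def gsSq {d : ℕ} (b : Fin d → Fin d → ℚ) (i : Fin d) : ℚ :=
  dotProduct (gramSchmidt b i) (gramSchmidt b i)

/-- The coefficient of `x` along the `j`-th Gram–Schmidt vector of `b`. -/
def gsCoeff {d : ℕ} (b : Fin d → Fin d → ℚ) (x : Fin d → ℚ) (j : Fin d) : ℚ :=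
  dotProduct x (gramSchmidt b j) / gsSq b j

/-- Replace `b i` by `b i - round (μ_ij) b j`. -/
def reduceAgainst {d : ℕ} (i : Fin d) (b : Fin d → Fin d → ℚ) (j : Fin d) :
    Fin d → Fin d → ℚ :=
  Function.update b i (b i - (round (gsCoeff b (b i) j) : ℚ) • b j)

/-- Size reduction: for `i = 0, …, d - 1` and, within it, `j = i - 1, …, 0`, reduce the `i`-th
vector against the `j`-th. -/
def sizeReduce {d : ℕ} (b : Fin d → Fin d → ℚ) : Fin d → Fin d → ℚ :=
  (List.finRange d).foldl
    (fun b i => ((List.finRange d).reverse.filter (fun j => j < i)).foldl (reduceAgainst i) b) b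

/-- The Lovász condition fails for the consecutive vectors `b i`, `b (i + 1)`. -/
def LovaszFails {d : ℕ} (b : Fin d → Fin d → ℚ) (i : Fin d) : Prop :=
  ∃ h : (i : ℕ) + 1 < d,
    gsSq b ⟨i + 1, h⟩ < (3 / 4 - gsCoeff b (b ⟨i + 1, h⟩) i ^ 2) * gsSq b i

instance {d : ℕ} (b : Fin d → Fin d → ℚ) : DecidablePred (LovaszFails b) :=
  fun i => by unfold LovaszFails; infer_instance

/-- Exchange the vectors `b i` and `b (i + 1)`. -/
def swapNext {d : ℕ} (b : Fin d → Fin d → ℚ) (i : Fin d) : Fin d → Fin d → ℚ :=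
  if h : (i : ℕ) + 1 < d then b ∘ Equiv.swap i ⟨i + 1, h⟩ else b

/-- One round of LLL: at the first place where the Lovász condition fails, exchange the two
vectors; then size-reduce again. -/
def lllStep {d : ℕ} (b : Fin d → Fin d → ℚ) : Fin d → Fin d → ℚ :=
  match (List.finRange d).find? (fun i => LovaszFails b i) with
  | some i => sizeReduce (swapNext b i)
  | none => b

/-- The LLL algorithm: size-reduce, and repeat the above as long as the Lovász condition fails
somewhere. -/
def lll {d : ℕ} (u : Fin d → Fin d → ℚ) : Part (Fin d → Fin d → ℚ) :=
  whileLoop (fun b => ∃ i, LovaszFails b i) lllStep (sizeReduce u)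

/-! ### Nearest plane rounding, and the binary search -/

/-- Nearest plane rounding of `c` with respect to the basis `b`: starting with the residue `c`,
for `i = d - 1, …, 0` subtract from the residue the multiple of `b i` by the rounded coefficient
along the `i`-th Gram–Schmidt vector. The lattice vector returned is `c` minus the final residue.
(Babai's algorithm for an arbitrary basis `u` is this procedure, run with the output `b` of
`lll u`.) -/
def nearestPlane {d : ℕ} (b : Fin d → Fin d → ℚ) (c : Fin d → ℚ) : Fin d → ℚ :=
  c - (List.finRange d).reverse.foldl
    (fun t i => t - (round (gsCoeff b t i) : ℚ) • b i) c

/-- The point `c (r) = (r, …, r, 1 - r)`. -/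
def center (d : ℕ) (r : ℚ) : Fin d → ℚ :=
  fun i => if (i : ℕ) + 1 = d then 1 - r else r

/-- Membership in `[0, ∞)^(d-1) × (-∞, 1)`. -/
def InRegion {d : ℕ} (x : Fin d → ℚ) : Prop :=
  ∀ i : Fin d, if (i : ℕ) + 1 = d then x i < 1 else 0 ≤ x i

instance {d : ℕ} : DecidablePred (InRegion (d := d)) :=
  fun x => by unfold InRegion; infer_instance

/-- The state of the binary search. -/
structure SearchState (d : ℕ) : Type where
  /-- the lower end of the search interval -/
  lo : ℚ
  /-- the upper end of the search interval -/
  hi : ℚ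
  /-- the current lattice point -/
  pt : Fin d → ℚ

/-- One bisection, with the reduced basis `b`. -/
def searchStep {d : ℕ} (b : Fin d → Fin d → ℚ) (s : SearchState d) : SearchState d :=
  if InRegion (nearestPlane b (center d ((s.lo + s.hi) / 2))) then
    ⟨s.lo, (s.lo + s.hi) / 2, nearestPlane b (center d ((s.lo + s.hi) / 2))⟩
  else
    ⟨(s.lo + s.hi) / 2, s.hi, s.pt⟩

/-- The binary search with accuracy `ε`, started from the basis `u` of the lattice. As the
algorithm is deterministic, the LLL reduction of `u`, which is common to all calls of Babai's
algorithm in the loop, is carried out once, before the loop. -/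
def latticeSearch {d : ℕ} (u : Fin d → Fin d → ℚ) (ε : ℚ) : Part (Fin d → ℚ) :=
  (lll u).bind fun b =>
    (whileLoop (fun s : SearchState d => ε < s.hi - s.lo) (searchStep b)
      ⟨0, 1, center d 1⟩).map SearchState.pt

/-- The additive algorithm with input `ν` and accuracy `δ`, where `u` is the basis of the lattice
`ℤ^d + ℤ ν` computed at the start: run the binary search with accuracy `δ / ⌈√d⌉`, and return the
point found modulo 1, or `ν` if that point is integral. -/
noncomputable def additiveAlgorithm {d : ℕ} (ν : Fin d → ℚ) (u : Fin d → Fin d → ℚ) (δ : ℚ) :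
    Part (Fin d → ℚ) :=
  (latticeSearch u (δ / (⌈Real.sqrt (d : ℝ)⌉₊ : ℚ))).map fun ξ =>
    if modOne ξ = 0 then ν else modOne ξ

end CGCut

namespace CGCut

/-! ### Gram–Schmidt orthogonalization over `ℚ` -/

/-! The numerator is bounded through the quality of nearest plane rounding, the denominator through
a volume argument.

Upper bound. LLL terminates because the product of the initial Gram determinants drops by the factor
3/4 at each exchange while bounded denominators keep it away from zero (`exists_mem_lll`). In the
reduced basis squared Gram–Schmidt lengths at most halve from one index to the next, so the rounding
error is controlled by the last one (`dotProduct_sub_nearestPlane_le`, `sum_gsSq_le`), whose length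
is at most 2τ (`gsSq_last_le`). The error is thus at most ρ = √(2^d - 1) τ. A center c(r) with r > ρ
always succeeds, since its ball of radius ρ lies in the region; hence the search ends with r ≤ ρ + ε
(`exists_mem_search`). The triangle inequality gives N(ξ) ≤ (1 + √d)ρ + √d ε, and √d ε ≤ δ. If ξ is
integral, this bound on N(ξ) is already at least √d ≥ N(ν), so returning ν does no harm
(`N_output_le`).

Lower bound. The minimum is the length of a nonzero lattice vector y (`exists_norm_eq_mAdd`). A box
with one side ‖y‖ along y and the others 2τ covers space under lattice translates, and the lattice
is a union of q cosets of ℤ^d, so 1 ≤ q‖y‖(2τ)^(d-1) (`one_le_mul_coveringRadius`). Also 1 ≤ q‖y‖,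
as qy is integral.

Multiplying the ρ term by the first quantity, bounding δ = 1/q by ‖y‖ and dividing by ‖y‖ gives the
ratio. -/

theorem gramSchmidt_eq {d : ℕ} (b : Fin d → Fin d → ℚ) (i : Fin d) :
    gramSchmidt b i = b i - ∑ j ∈ Finset.Iio i, gsCoeff b (b i) j • gramSchmidt b j := by
  rw [gramSchmidt, ← Finset.sum_coe_sort (Finset.Iio i)]
  rfl

theorem gsSq_eq_zero_iff {d : ℕ} {b : Fin d → Fin d → ℚ} {i : Fin d} :
    gsSq b i = 0 ↔ gramSchmidt b i = 0 := dotProduct_self_eq_zero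

theorem gsSq_nonneg {d : ℕ} (b : Fin d → Fin d → ℚ) (i : Fin d) : 0 ≤ gsSq b i :=
  Finset.sum_nonneg fun k _ => mul_self_nonneg (gramSchmidt b i k)

theorem gsCoeff_mul_gsSq {d : ℕ} (b : Fin d → Fin d → ℚ) (x : Fin d → ℚ) (j : Fin d) :
    gsCoeff b x j * gsSq b j = dotProduct x (gramSchmidt b j) := by
  by_cases h : gsSq b j = 0
  · rw [gsSq_eq_zero_iff.1 h, dotProduct_zero, h, mul_zero]
  · exact div_mul_cancel₀ _ h

theorem gramSchmidt_sub_mem {d : ℕ} (b : Fin d → Fin d → ℚ) (i : Fin d) :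
    gramSchmidt b i - b i ∈ Submodule.span ℚ (b '' Set.Iio i) := by
  induction i using WellFoundedLT.induction with
  | ind i ih =>
    rw [gramSchmidt_eq, sub_sub_cancel_left]
    refine neg_mem (Submodule.sum_mem _ fun j hj => Submodule.smul_mem _ _ ?_)
    have hj' : j < i := Finset.mem_Iio.1 hj
    have h1 := Submodule.span_mono (Set.image_mono (Set.Iio_subset_Iio hj'.le)) (ih j hj')
    have h2 : b j ∈ Submodule.span ℚ (b '' Set.Iio i) :=
      Submodule.subset_span ⟨j, hj', rfl⟩
    simpa using add_mem h1 h2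

theorem dotProduct_gramSchmidt_of_lt {d : ℕ} (b : Fin d → Fin d → ℚ) {i j : Fin d} (h : j < i) :
    dotProduct (gramSchmidt b i) (gramSchmidt b j) = 0 := by
  induction i using WellFoundedLT.induction generalizing j with
  | ind i ih =>
    rw [gramSchmidt_eq b i, sub_dotProduct, sum_dotProduct,
      Finset.sum_eq_single_of_mem j (Finset.mem_Iio.2 h), smul_dotProduct, smul_eq_mul]
    · exact sub_eq_zero.2 (gsCoeff_mul_gsSq b (b i) j).symm
    · intro k hk hkj
      rw [smul_dotProduct, smul_eq_mul]
      rcases lt_or_gt_of_ne hkj with hlt | hlt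
      · rw [dotProduct_comm, ih j h hlt, mul_zero]
      · rw [ih k (Finset.mem_Iio.1 hk) hlt, mul_zero]

theorem dotProduct_gramSchmidt_of_ne {d : ℕ} (b : Fin d → Fin d → ℚ) {i j : Fin d} (h : i ≠ j) :
    dotProduct (gramSchmidt b i) (gramSchmidt b j) = 0 := by
  rcases lt_or_gt_of_ne h with h | h
  · rw [dotProduct_comm, dotProduct_gramSchmidt_of_lt b h]
  · exact dotProduct_gramSchmidt_of_lt b h

theorem eq_add_gramSchmidt {d : ℕ} (b : Fin d → Fin d → ℚ) (i : Fin d) :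
    b i = gramSchmidt b i + ∑ j ∈ Finset.Iio i, gsCoeff b (b i) j • gramSchmidt b j := by
  rw [gramSchmidt_eq b i]; abel

theorem dotProduct_gramSchmidt_basis_of_lt {d : ℕ} (b : Fin d → Fin d → ℚ) {i j : Fin d}
    (h : j < i) : dotProduct (gramSchmidt b i) (b j) = 0 := by
  rw [eq_add_gramSchmidt b j, dotProduct_add, dotProduct_gramSchmidt_of_lt b h, zero_add,
    dotProduct_sum]
  refine Finset.sum_eq_zero fun k hk => ?_
  rw [dotProduct_smul, dotProduct_gramSchmidt_of_lt b ((Finset.mem_Iio.1 hk).trans h), smul_zero]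

theorem dotProduct_gramSchmidt_basis_self {d : ℕ} (b : Fin d → Fin d → ℚ) (i : Fin d) :
    dotProduct (gramSchmidt b i) (b i) = gsSq b i := by
  conv_lhs => rw [eq_add_gramSchmidt b i]
  rw [dotProduct_add, dotProduct_sum, Finset.sum_eq_zero, add_zero]
  · rfl
  intro k hk
  rw [dotProduct_smul, dotProduct_gramSchmidt_of_lt b (Finset.mem_Iio.1 hk), smul_zero]

theorem gsCoeff_basis_of_lt {d : ℕ} (b : Fin d → Fin d → ℚ) {i j : Fin d} (h : j < i) :
    gsCoeff b (b j) i = 0 := by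
  rw [gsCoeff, dotProduct_comm, dotProduct_gramSchmidt_basis_of_lt b h, zero_div]

theorem gsCoeff_basis_self {d : ℕ} {b : Fin d → Fin d → ℚ} {i : Fin d} (h : 0 < gsSq b i) :
    gsCoeff b (b i) i = 1 := by
  rw [gsCoeff, dotProduct_comm, dotProduct_gramSchmidt_basis_self b, div_self h.ne']

theorem gsCoeff_sub_smul {d : ℕ} (b : Fin d → Fin d → ℚ) (x y : Fin d → ℚ) (c : ℚ) (j : Fin d) :
    gsCoeff b (x - c • y) j = gsCoeff b x j - c * gsCoeff b y j := by
  simp only [gsCoeff, sub_dotProduct, smul_dotProduct, smul_eq_mul]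
  ring

theorem dotProduct_eq_zero_of_mem_span {d : ℕ} {s : Set (Fin d → ℚ)} {w x : Fin d → ℚ}
    (hw : ∀ y ∈ s, dotProduct w y = 0) (hx : x ∈ Submodule.span ℚ s) : dotProduct w x = 0 := by
  induction hx using Submodule.span_induction with
  | mem y hy => exact hw y hy
  | zero => exact dotProduct_zero _
  | add y z _ _ hy hz => rw [dotProduct_add, hy, hz, add_zero]
  | smul c y _ hy => rw [dotProduct_smul, hy, smul_zero]

/-- The `i`-th Gram–Schmidt vector is the only vector that is congruent to `b i` modulo the span
of the previous vectors, and orthogonal to them. -/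
theorem eq_gramSchmidt {d : ℕ} {b : Fin d → Fin d → ℚ} {i : Fin d} {v : Fin d → ℚ}
    (h1 : v - b i ∈ Submodule.span ℚ (b '' Set.Iio i)) (h2 : ∀ j < i, dotProduct v (b j) = 0) :
    v = gramSchmidt b i := by
  have hmem : v - gramSchmidt b i ∈ Submodule.span ℚ (b '' Set.Iio i) := by
    have := sub_mem h1 (gramSchmidt_sub_mem b i)
    simpa using this
  have horth : ∀ y ∈ b '' Set.Iio i, dotProduct (v - gramSchmidt b i) y = 0 := by
    rintro _ ⟨j, hj, rfl⟩
    rw [sub_dotProduct, h2 j hj, dotProduct_gramSchmidt_basis_of_lt b hj, sub_zero]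
  exact sub_eq_zero.1 (dotProduct_self_eq_zero.1 (dotProduct_eq_zero_of_mem_span horth hmem))

/-- A Gram–Schmidt vector depends only on the span of the earlier rows and on its own row modulo
that span. This handles both row reductions and exchanges. -/
theorem gramSchmidt_congr {d : ℕ} {b b' : Fin d → Fin d → ℚ} {i : Fin d}
    (h1 : b i - b' i ∈ Submodule.span ℚ (b '' Set.Iio i))
    (h2 : Submodule.span ℚ (b' '' Set.Iio i) = Submodule.span ℚ (b '' Set.Iio i)) :
    gramSchmidt b' i = gramSchmidt b i := by
  refine (eq_gramSchmidt ?_ fun j hj => ?_).symm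
  · rw [h2]
    simpa using add_mem (gramSchmidt_sub_mem b i) h1
  · refine dotProduct_eq_zero_of_mem_span (s := b '' Set.Iio i) ?_ ?_
    · rintro _ ⟨k, hk, rfl⟩
      exact dotProduct_gramSchmidt_basis_of_lt b hk
    · rw [← h2]
      exact Submodule.subset_span ⟨j, hj, rfl⟩

theorem gsSq_congr {d : ℕ} {b b' : Fin d → Fin d → ℚ} (h : gramSchmidt b' = gramSchmidt b) :
    gsSq b' = gsSq b := by
  funext i; rw [gsSq, gsSq, h]

theorem gsCoeff_congr {d : ℕ} {b b' : Fin d → Fin d → ℚ} (h : gramSchmidt b' = gramSchmidt b) :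
    gsCoeff b' = gsCoeff b := by
  funext x i; rw [gsCoeff, gsCoeff, gsSq_congr h, h]

/-- Expansion of a vector in the orthogonal basis of Gram–Schmidt vectors. -/
theorem sum_gsCoeff_smul {d : ℕ} {b : Fin d → Fin d → ℚ} (hb : ∀ i, 0 < gsSq b i)
    (x : Fin d → ℚ) : ∑ j, gsCoeff b x j • gramSchmidt b j = x := by
  have hli : LinearIndependent ℚ (gramSchmidt b) := by
    rw [Fintype.linearIndependent_iff]
    intro g hg i
    have h := congrArg (fun y => dotProduct y (gramSchmidt b i)) hg
    simp only [sum_dotProduct, zero_dotProduct] at h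
    rw [Finset.sum_eq_single_of_mem i (Finset.mem_univ _)] at h
    · rw [smul_dotProduct, smul_eq_mul] at h
      exact (mul_eq_zero.1 h).resolve_right (hb i).ne'
    · intro j _ hj
      rw [smul_dotProduct, dotProduct_gramSchmidt_of_ne b hj, smul_zero]
  -- The d independent Gram–Schmidt vectors span ℚ^d, so a remainder orthogonal to all of them
  -- vanishes.
  have htop := hli.span_eq_top_of_card_eq_finrank' (by simp)
  refine (sub_eq_zero.1 (dotProduct_self_eq_zero.1
    (dotProduct_eq_zero_of_mem_span (s := Set.range (gramSchmidt b)) ?_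
      (htop ▸ Submodule.mem_top)))).symm
  rintro _ ⟨i, rfl⟩
  rw [sub_dotProduct, sum_dotProduct, Finset.sum_eq_single_of_mem i (Finset.mem_univ _),
    smul_dotProduct, smul_eq_mul]
  · exact sub_eq_zero.2 (gsCoeff_mul_gsSq b x i).symm
  · intro j _ hj
    rw [smul_dotProduct, dotProduct_gramSchmidt_of_ne b hj, smul_zero]

theorem dotProduct_eq_sum_gsCoeff {d : ℕ} {b : Fin d → Fin d → ℚ} (hb : ∀ i, 0 < gsSq b i)
    (x y : Fin d → ℚ) :
    dotProduct x y = ∑ j, gsCoeff b x j * gsSq b j * gsCoeff b y j := by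
  conv_lhs => rw [← sum_gsCoeff_smul hb y]
  rw [dotProduct_sum]
  refine Finset.sum_congr rfl fun j _ => ?_
  rw [dotProduct_smul, ← gsCoeff_mul_gsSq, smul_eq_mul, mul_comm]

theorem gsSq_pos_of_linearIndependent {d : ℕ} {b : Fin d → Fin d → ℚ}
    (h : LinearIndependent ℚ b) (i : Fin d) : 0 < gsSq b i := by
  refine (gsSq_nonneg b i).lt_of_ne fun h0 => ?_
  have h1 := gramSchmidt_sub_mem b i
  rw [gsSq_eq_zero_iff.1 h0.symm, zero_sub] at h1
  exact h.notMem_span_image (s := Set.Iio i) (lt_irrefl i) (by simpa using neg_mem h1)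

/-- The Gram determinant of an initial segment of `b` is the product of the squared lengths of the
Gram–Schmidt vectors. -/
theorem det_gram_eq_prod_gsSq {d : ℕ} {b : Fin d → Fin d → ℚ} (hb : ∀ i, 0 < gsSq b i)
    (i : Fin d) :
    (Matrix.of fun k m : Finset.Iic i => dotProduct (b k) (b m)).det =
      ∏ k ∈ Finset.Iic i, gsSq b k := by
  -- The rows written in the orthogonal frame form a unit lower triangular matrix U, and the Gram
  -- matrix is U D Uᵀ with D diagonal.
  set U : Matrix (Finset.Iic i) (Finset.Iic i) ℚ := Matrix.of fun k m => gsCoeff b (b k) m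
  have hU : U.det = 1 := by
    rw [Matrix.det_of_isLowerTriangular U]
    · exact Finset.prod_eq_one fun k _ => gsCoeff_basis_self (hb k)
    · intro k m hkm
      exact gsCoeff_basis_of_lt b hkm
  have hG : (Matrix.of fun k m : Finset.Iic i => dotProduct (b k) (b m)) =
      U * Matrix.diagonal (fun k : Finset.Iic i => gsSq b k) * U.transpose := by
    ext k m
    rw [Matrix.mul_apply, Matrix.of_apply, dotProduct_eq_sum_gsCoeff hb]
    simp only [Matrix.mul_diagonal, Matrix.transpose_apply, U, Matrix.of_apply]
    rw [Finset.sum_coe_sort (Finset.Iic i)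
      (fun x => gsCoeff b (b k) x * gsSq b x * gsCoeff b (b m) x)]
    refine (Finset.sum_subset (Finset.subset_univ _) fun x _ hx => ?_).symm
    have hx' : i < x := not_le.1 fun h => hx (Finset.mem_Iic.2 h)
    rw [gsCoeff_basis_of_lt b ((Finset.mem_Iic.1 k.2).trans_lt hx'), zero_mul, zero_mul]
  rw [hG, Matrix.det_mul, Matrix.det_mul, Matrix.det_transpose, hU, Matrix.det_diagonal, one_mul,
    mul_one, Finset.prod_coe_sort (Finset.Iic i) (gsSq b)]

/-! ### Elementary transformations of a basis -/

/-- Row i moves by a multiple of an earlier row, so it keeps its class modulo the earlier rows and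
no initial span changes. -/
theorem gramSchmidt_update {d : ℕ} (b : Fin d → Fin d → ℚ) {i j : Fin d} (h : j < i) (c : ℚ) :
    gramSchmidt (Function.update b i (b i - c • b j)) = gramSchmidt b := by
  set b' := Function.update b i (b i - c • b j) with hb'
  have hne : ∀ k, k ≠ i → b' k = b k := fun k hk => Function.update_of_ne hk _ _
  have hi : b' i = b i - c • b j := Function.update_self _ _ _
  funext k
  refine gramSchmidt_congr ?_ (le_antisymm ?_ ?_)
  · by_cases hk : k = i
    · subst hk
      rw [hi, sub_sub_cancel]
      exact Submodule.smul_mem _ _ (Submodule.subset_span ⟨j, h, rfl⟩)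
    · rw [hne k hk, sub_self]
      exact zero_mem _
  · rw [Submodule.span_le]
    rintro _ ⟨l, hl, rfl⟩
    by_cases hli : l = i
    · subst hli
      rw [hi]
      exact sub_mem (Submodule.subset_span ⟨l, hl, rfl⟩)
        (Submodule.smul_mem _ _ (Submodule.subset_span ⟨j, h.trans hl, rfl⟩))
    · rw [hne l hli]
      exact Submodule.subset_span ⟨l, hl, rfl⟩
  · rw [Submodule.span_le]
    rintro _ ⟨l, hl, rfl⟩
    by_cases hli : l = i
    · subst hli
      have : b l = b' l + c • b' j := by rw [hi, hne j h.ne]; abel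
      rw [this]
      exact add_mem (Submodule.subset_span ⟨l, hl, rfl⟩)
        (Submodule.smul_mem _ _ (Submodule.subset_span ⟨j, h.trans hl, rfl⟩))
    · rw [← hne l hli]
      exact Submodule.subset_span ⟨l, hl, rfl⟩

theorem span_range_update {d : ℕ} (b : Fin d → Fin d → ℚ) {i j : Fin d} (h : j ≠ i) (c : ℤ) :
    Submodule.span ℤ (Set.range (Function.update b i (b i - (c : ℚ) • b j))) =
      Submodule.span ℤ (Set.range b) := by
  set b' := Function.update b i (b i - (c : ℚ) • b j) with hb'
  have hne : ∀ k, k ≠ i → b' k = b k := fun k hk => Function.update_of_ne hk _ _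
  have hi : b' i = b i - c • b j := by
    rw [hb', Function.update_self, Int.cast_smul_eq_zsmul]
  refine le_antisymm ?_ ?_
  · rw [Submodule.span_le]
    rintro _ ⟨l, rfl⟩
    by_cases hli : l = i
    · rw [hli, hi]
      exact sub_mem (Submodule.subset_span ⟨i, rfl⟩)
        (Submodule.smul_mem _ _ (Submodule.subset_span ⟨j, rfl⟩))
    · rw [hne l hli]
      exact Submodule.subset_span ⟨l, rfl⟩
  · rw [Submodule.span_le]
    rintro _ ⟨l, rfl⟩
    by_cases hli : l = i
    · have : b l = b' i + c • b' j := by rw [hi, hne j h, hli]; abel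
      rw [this]
      exact add_mem (Submodule.subset_span ⟨i, rfl⟩)
        (Submodule.smul_mem _ _ (Submodule.subset_span ⟨j, rfl⟩))
    · rw [← hne l hli]
      exact Submodule.subset_span ⟨l, rfl⟩

theorem span_range_swapNext {d : ℕ} (b : Fin d → Fin d → ℚ) (i : Fin d) :
    Submodule.span ℤ (Set.range (swapNext b i)) = Submodule.span ℤ (Set.range b) := by
  unfold swapNext
  split_ifs with h
  · rw [Set.range_comp, Equiv.range_eq_univ, Set.image_univ]
  · rfl

/-! ### Exchanging two consecutive basis vectors -/

section Swap

variable {d : ℕ} (b : Fin d → Fin d → ℚ) (i : Fin d) (h : (i : ℕ) + 1 < d)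

theorem swapNext_apply_left : swapNext b i i = b ⟨i + 1, h⟩ := by
  simp [swapNext, h]

theorem swapNext_apply_right : swapNext b i ⟨i + 1, h⟩ = b i := by
  simp [swapNext, h]

theorem swapNext_apply_of_ne {k : Fin d} (h1 : k ≠ i) (h2 : k ≠ ⟨i + 1, h⟩) :
    swapNext b i k = b k := by
  simp [swapNext, h, Equiv.swap_apply_of_ne_of_ne h1 h2]

theorem swapNext_image_Iio_of_le (h : (i : ℕ) + 1 < d) {k : Fin d} (hk : k ≤ i) :
    swapNext b i '' Set.Iio k = b '' Set.Iio k := by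
  refine Set.image_congr fun j hj => swapNext_apply_of_ne b i h ?_ ?_
  · exact (lt_of_lt_of_le hj hk).ne
  · have := lt_of_lt_of_le hj hk
    exact fun h' => by subst h'; simp [Fin.lt_def] at this

theorem swapNext_image_Iio_of_lt {k : Fin d} (hk : ⟨i + 1, h⟩ < k) :
    swapNext b i '' Set.Iio k = b '' Set.Iio k := by
  have hik : i < k := lt_trans (by simp [Fin.lt_def]) hk
  ext x
  constructor
  · rintro ⟨j, hj, rfl⟩
    by_cases h1 : j = i
    · subst h1; exact ⟨_, hk, (swapNext_apply_left b j h).symm⟩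
    by_cases h2 : j = ⟨i + 1, h⟩
    · subst h2; exact ⟨_, hik, (swapNext_apply_right b i h).symm⟩
    exact ⟨j, hj, (swapNext_apply_of_ne b i h h1 h2).symm⟩
  · rintro ⟨j, hj, rfl⟩
    by_cases h1 : j = i
    · subst h1; exact ⟨_, hk, swapNext_apply_right b j h⟩
    by_cases h2 : j = ⟨i + 1, h⟩
    · subst h2; exact ⟨_, hik, swapNext_apply_left b i h⟩
    exact ⟨j, hj, swapNext_apply_of_ne b i h h1 h2⟩

theorem gramSchmidt_swapNext_of_ne {k : Fin d} (h1 : k ≠ i) (h2 : k ≠ ⟨i + 1, h⟩) :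
    gramSchmidt (swapNext b i) k = gramSchmidt b k := by
  refine gramSchmidt_congr ?_ ?_
  · rw [swapNext_apply_of_ne b i h h1 h2, sub_self]
    exact zero_mem _
  · rcases lt_or_gt_of_ne h1 with hk | hk
    · rw [swapNext_image_Iio_of_le b i h hk.le]
    · rw [swapNext_image_Iio_of_lt b i h]
      have : (k : ℕ) ≠ i + 1 := fun h' => h2 (Fin.ext h')
      rw [Fin.lt_def] at hk ⊢
      simp only
      omega

/-- The old row i + 1 is now projected away from the rows before i only, so its component along the
old i-th Gram–Schmidt vector survives. -/
theorem gramSchmidt_swapNext_left :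
    gramSchmidt (swapNext b i) i =
      gramSchmidt b ⟨i + 1, h⟩ + gsCoeff b (b ⟨i + 1, h⟩) i • gramSchmidt b i := by
  have hlt : i < ⟨i + 1, h⟩ := by simp [Fin.lt_def]
  refine (eq_gramSchmidt ?_ fun j hj => ?_).symm
  · rw [swapNext_apply_left b i h, swapNext_image_Iio_of_le b i h le_rfl, gramSchmidt_eq b ⟨i + 1, h⟩]
    have hI : Finset.Iio (⟨i + 1, h⟩ : Fin d) = insert i (Finset.Iio i) := by
      ext k; simp only [Finset.mem_Iio, Finset.mem_insert, Fin.lt_def, Fin.ext_iff]; omega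
    rw [hI, Finset.sum_insert (by simp)]
    have hs : ∑ j ∈ Finset.Iio i, gsCoeff b (b ⟨i + 1, h⟩) j • gramSchmidt b j ∈
        Submodule.span ℚ (b '' Set.Iio i) := by
      refine Submodule.sum_mem _ fun j hj => Submodule.smul_mem _ _ ?_
      have hj' : j < i := Finset.mem_Iio.1 hj
      have h1 := Submodule.span_mono (Set.image_mono (Set.Iio_subset_Iio hj'.le))
        (gramSchmidt_sub_mem b j)
      have h2 : b j ∈ Submodule.span ℚ (b '' Set.Iio i) := Submodule.subset_span ⟨j, hj', rfl⟩
      simpa using add_mem h1 h2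
    convert neg_mem hs using 1
    abel
  · have hj2 : j ≠ ⟨i + 1, h⟩ := (hj.trans hlt).ne
    rw [swapNext_apply_of_ne b i h hj.ne hj2, add_dotProduct, smul_dotProduct,
      dotProduct_gramSchmidt_basis_of_lt b hj,
      dotProduct_gramSchmidt_basis_of_lt b (hj.trans hlt), smul_zero, add_zero]

theorem gsSq_swapNext_left :
    gsSq (swapNext b i) i =
      gsSq b ⟨i + 1, h⟩ + gsCoeff b (b ⟨i + 1, h⟩) i ^ 2 * gsSq b i := by
  have hlt : i < ⟨i + 1, h⟩ := by simp [Fin.lt_def]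
  rw [gsSq, gramSchmidt_swapNext_left b i h]
  simp only [add_dotProduct, dotProduct_add, smul_dotProduct, dotProduct_smul, smul_eq_mul,
    dotProduct_gramSchmidt_of_ne b hlt.ne, dotProduct_gramSchmidt_of_ne b hlt.ne', gsSq]
  ring

/-- Modulo the earlier rows, the two exchanged rows span the same parallelogram before and after;
both sides are its squared area. -/
theorem gsSq_swapNext_right (hb : ∀ k, 0 < gsSq b k) :
    gsSq (swapNext b i) i * gsSq (swapNext b i) ⟨i + 1, h⟩ = gsSq b i * gsSq b ⟨i + 1, h⟩ := by
  have hlt : i < ⟨i + 1, h⟩ := by simp [Fin.lt_def]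
  set μ := gsCoeff b (b ⟨i + 1, h⟩) i with hμ
  set H := gsSq (swapNext b i) i with hH
  have hHeq : H = gsSq b ⟨i + 1, h⟩ + μ ^ 2 * gsSq b i := gsSq_swapNext_left b i h
  have hHpos : 0 < H := by
    rw [hHeq]; have := hb i; have := hb ⟨i + 1, h⟩; positivity
  have hib : dotProduct (gramSchmidt b i) (b ⟨i + 1, h⟩) = μ * gsSq b i := by
    rw [dotProduct_comm, ← gsCoeff_mul_gsSq]
  -- The second new vector is the old i-th one minus its projection onto the first new one.
  have hv : gramSchmidt b i - (μ * gsSq b i / H) • gramSchmidt (swapNext b i) i =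
      gramSchmidt (swapNext b i) ⟨i + 1, h⟩ := by
    refine eq_gramSchmidt ?_ fun j hj => ?_
    · rw [swapNext_apply_right b i h]
      have h1 : gramSchmidt b i - b i ∈
          Submodule.span ℚ (swapNext b i '' Set.Iio ⟨i + 1, h⟩) := by
        refine Submodule.span_mono ?_ (gramSchmidt_sub_mem b i)
        rw [← swapNext_image_Iio_of_le b i h le_rfl]
        exact Set.image_mono (Set.Iio_subset_Iio hlt.le)
      have h2 : gramSchmidt (swapNext b i) i ∈
          Submodule.span ℚ (swapNext b i '' Set.Iio ⟨i + 1, h⟩) := by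
        have h3 := Submodule.span_mono (Set.image_mono (Set.Iio_subset_Iio hlt.le))
          (gramSchmidt_sub_mem (swapNext b i) i)
        have h4 : swapNext b i i ∈ Submodule.span ℚ (swapNext b i '' Set.Iio ⟨i + 1, h⟩) :=
          Submodule.subset_span ⟨i, hlt, rfl⟩
        simpa using add_mem h3 h4
      convert sub_mem h1 (Submodule.smul_mem _ (μ * gsSq b i / H) h2) using 1
      abel
    · by_cases hji : j = i
      · subst hji
        rw [sub_dotProduct, smul_dotProduct, dotProduct_gramSchmidt_basis_self,
          swapNext_apply_left b j h, hib, smul_eq_mul, ← hH, div_mul_cancel₀ _ hHpos.ne', sub_self]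
      · have hj' : j < i := by
          refine lt_of_le_of_ne ?_ hji
          rw [Fin.lt_def] at hj; rw [Fin.le_def]; simp only at hj; omega
        rw [sub_dotProduct, smul_dotProduct, dotProduct_gramSchmidt_basis_of_lt _ hj',
          swapNext_apply_of_ne b i h hji hj.ne, dotProduct_gramSchmidt_basis_of_lt _ hj',
          smul_zero, sub_zero]
  have hgv : dotProduct (gramSchmidt b i) (gramSchmidt (swapNext b i) i) = μ * gsSq b i := by
    rw [gramSchmidt_swapNext_left b i h, dotProduct_add, dotProduct_smul,
      dotProduct_gramSchmidt_of_ne b hlt.ne, zero_add]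
    rfl
  have hsq : gsSq (swapNext b i) ⟨i + 1, h⟩ = gsSq b i - (μ * gsSq b i) ^ 2 / H := by
    rw [gsSq, ← hv]
    simp only [sub_dotProduct, dotProduct_sub, smul_dotProduct, dotProduct_smul, smul_eq_mul, hgv,
      dotProduct_comm (gramSchmidt (swapNext b i) i) (gramSchmidt b i)]
    rw [show dotProduct (gramSchmidt (swapNext b i) i) (gramSchmidt (swapNext b i) i) = H from rfl,
      show dotProduct (gramSchmidt b i) (gramSchmidt b i) = gsSq b i from rfl]
    field_simp
    ring
  rw [hsq, mul_sub, mul_div_cancel₀ _ hHpos.ne', hHeq]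
  ring

end Swap

/-! ### While loops -/

theorem iterate_of_forall_cond {σ : Type} {step : σ → σ} {cond I : σ → Prop}
    (hI : ∀ s, I s → cond s → I (step s)) {s : σ} (hs : I s) {n : ℕ}
    (hn : ∀ m < n, cond (step^[m] s)) : I (step^[n] s) := by
  induction n with
  | zero => exact hs
  | succ n ih =>
    rw [Function.iterate_succ_apply']
    exact hI _ (ih fun m hm => hn m (hm.trans n.lt_succ_self)) (hn n n.lt_succ_self)

/-- A while loop with invariant `I` terminates if a positive potential `V` with a positive lower
bound decreases by a constant factor; its value satisfies the invariant. -/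
theorem exists_mem_whileLoop {σ : Type} {cond : σ → Prop} [DecidablePred cond] {step : σ → σ}
    {I : σ → Prop} (hI : ∀ s, I s → cond s → I (step s)) {s : σ} (hs : I s) (V : σ → ℚ) {κ c : ℚ}
    (hκ : 0 < κ) (hc0 : 0 ≤ c) (hc : c < 1) (hV : ∀ s, I s → cond s → κ ≤ V s)
    (hstep : ∀ s, I s → cond s → V (step s) ≤ c * V s) :
    ∃ t ∈ whileLoop cond step s, I t ∧ ¬ cond t := by
  have hterm : ∃ n : ℕ, ¬ cond (step^[n] s) := by
    by_contra! hall
    have hIn : ∀ n, I (step^[n] s) := fun n => iterate_of_forall_cond hI hs fun m _ => hall m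
    have hle : ∀ n, V (step^[n] s) ≤ c ^ n * V s := by
      intro n
      induction n with
      | zero => simp
      | succ n ih =>
        rw [Function.iterate_succ_apply', pow_succ', mul_assoc]
        exact (hstep _ (hIn n) (hall n)).trans (mul_le_mul_of_nonneg_left ih hc0)
    have hVs : 0 < V s := hκ.trans_le (hV s hs (hall 0))
    obtain ⟨n, hn⟩ := exists_pow_lt_of_lt_one (div_pos hκ hVs) hc
    have := (hV _ (hIn n) (hall n)).trans (hle n)
    rw [lt_div_iff₀ hVs] at hn
    exact absurd this (not_le.2 hn)
  refine ⟨_, ⟨hterm, rfl⟩, ?_, Nat.find_spec hterm⟩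
  exact iterate_of_forall_cond hI hs fun m hm => not_not.1 (Nat.find_min hterm hm)

/-! ### Nearest plane steps and size reduction -/

/-- Nearest plane steps for the indices in the list `l`. -/
def planeSteps {d : ℕ} (b : Fin d → Fin d → ℚ) (t : Fin d → ℚ) (l : List (Fin d)) : Fin d → ℚ :=
  l.foldl (fun t i => t - (round (gsCoeff b t i) : ℚ) • b i) t

theorem planeSteps_nil {d : ℕ} (b : Fin d → Fin d → ℚ) (t : Fin d → ℚ) :
    planeSteps b t [] = t := rfl

theorem planeSteps_cons {d : ℕ} (b : Fin d → Fin d → ℚ) (t : Fin d → ℚ) (k : Fin d)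
    (l : List (Fin d)) :
    planeSteps b t (k :: l) = planeSteps b (t - (round (gsCoeff b t k) : ℚ) • b k) l := rfl

/-- Rows with index below j have no component along the j-th Gram–Schmidt vector, so subtracting
them leaves that coefficient alone. -/
theorem gsCoeff_planeSteps_of_forall_lt {d : ℕ} (b : Fin d → Fin d → ℚ) {j : Fin d}
    {l : List (Fin d)} (hl : ∀ k ∈ l, k < j) (t : Fin d → ℚ) :
    gsCoeff b (planeSteps b t l) j = gsCoeff b t j := by
  induction l generalizing t with
  | nil => rfl
  | cons k l ih =>
    rw [planeSteps_cons, ih fun m hm => hl m (List.mem_cons_of_mem _ hm),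
      gsCoeff_sub_smul, gsCoeff_basis_of_lt b (hl k List.mem_cons_self), mul_zero, sub_zero]

/-- The descending order is essential: each step rounds its own coefficient into [-1/2, 1/2], and
the later steps, having smaller index, do not disturb it. -/
theorem abs_gsCoeff_planeSteps_le {d : ℕ} {b : Fin d → Fin d → ℚ} (hb : ∀ i, 0 < gsSq b i)
    {l : List (Fin d)} (hl : l.Pairwise (· > ·)) (t : Fin d → ℚ) {j : Fin d} (hj : j ∈ l) :
    |gsCoeff b (planeSteps b t l) j| ≤ 1 / 2 := by
  induction l generalizing t with
  | nil => cases hj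
  | cons k l ih =>
    rw [List.pairwise_cons] at hl
    rw [planeSteps_cons]
    rcases List.mem_cons.1 hj with rfl | hj
    · rw [gsCoeff_planeSteps_of_forall_lt b hl.1, gsCoeff_sub_smul, gsCoeff_basis_self (hb j),
        mul_one]
      exact abs_sub_round _
    · exact ih hl.2 _ hj

theorem planeSteps_congr {d : ℕ} {b b' : Fin d → Fin d → ℚ} (h : gramSchmidt b' = gramSchmidt b)
    {l : List (Fin d)} (hl : ∀ k ∈ l, b' k = b k) (t : Fin d → ℚ) :
    planeSteps b' t l = planeSteps b t l := by
  induction l generalizing t with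
  | nil => rw [planeSteps_nil, planeSteps_nil]
  | cons k l ih =>
    rw [planeSteps_cons, planeSteps_cons, ih fun m hm => hl m (List.mem_cons_of_mem _ hm),
      gsCoeff_congr h, hl k List.mem_cons_self]

/-- The rows `b` and `b'` have the same Gram–Schmidt vectors and generate the same lattice. -/
def SameLattice {d : ℕ} (b b' : Fin d → Fin d → ℚ) : Prop :=
  gramSchmidt b' = gramSchmidt b ∧
    Submodule.span ℤ (Set.range b') = Submodule.span ℤ (Set.range b)

theorem SameLattice.trans {d : ℕ} {b b' b'' : Fin d → Fin d → ℚ} (h : SameLattice b b')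
    (h' : SameLattice b' b'') : SameLattice b b'' :=
  ⟨h'.1.trans h.1, h'.2.trans h.2⟩

/-- Reducing row i is nearest plane rounding of that row: the earlier rows and all Gram–Schmidt
vectors stay fixed meanwhile. One estimate then serves both LLL and Babai rounding. -/
theorem foldl_reduceAgainst {d : ℕ} {i : Fin d} {l : List (Fin d)} (hl : ∀ k ∈ l, k < i)
    (b : Fin d → Fin d → ℚ) :
    l.foldl (reduceAgainst i) b = Function.update b i (planeSteps b (b i) l) ∧
      SameLattice b (l.foldl (reduceAgainst i) b) := by
  induction l generalizing b with
  | nil => simp [planeSteps, SameLattice]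
  | cons j l ih =>
    have hj : j < i := hl j List.mem_cons_self
    have hl' : ∀ k ∈ l, k < i := fun k hk => hl k (List.mem_cons_of_mem _ hk)
    have hgs : gramSchmidt (reduceAgainst i b j) = gramSchmidt b := gramSchmidt_update b hj _
    obtain ⟨h1, h2⟩ := ih hl' (reduceAgainst i b j)
    rw [List.foldl_cons]
    refine ⟨?_, SameLattice.trans ⟨hgs, span_range_update b hj.ne _⟩ h2⟩
    rw [h1, planeSteps_congr hgs fun k hk => Function.update_of_ne (hl' k hk).ne _ _]
    simp only [reduceAgainst, Function.update_idem, Function.update_self]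
    rfl

/-- The inner loop of size reduction. -/
def reduceRow {d : ℕ} (b : Fin d → Fin d → ℚ) (i : Fin d) : Fin d → Fin d → ℚ :=
  ((List.finRange d).reverse.filter (fun j => j < i)).foldl (reduceAgainst i) b

/-- The `i`-th row is size-reduced. -/
def RowReduced {d : ℕ} (b : Fin d → Fin d → ℚ) (i : Fin d) : Prop :=
  ∀ j < i, |gsCoeff b (b i) j| ≤ 1 / 2

theorem pairwise_finRange_reverse (d : ℕ) : (List.finRange d).reverse.Pairwise (· > ·) := by
  rw [List.pairwise_reverse]
  exact List.pairwise_lt_finRange d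

theorem sameLattice_reduceRow {d : ℕ} (b : Fin d → Fin d → ℚ) (i : Fin d) :
    SameLattice b (reduceRow b i) :=
  (foldl_reduceAgainst (fun k hk => by simpa using (List.mem_filter.1 hk).2) b).2

theorem rowReduced_reduceRow {d : ℕ} {b : Fin d → Fin d → ℚ} (hb : ∀ i, 0 < gsSq b i)
    (i : Fin d) {k : Fin d} (hk : k = i ∨ RowReduced b k) : RowReduced (reduceRow b i) k := by
  intro j hj
  rw [gsCoeff_congr (sameLattice_reduceRow b i).1, reduceRow,
    (foldl_reduceAgainst (fun k hk => by simpa using (List.mem_filter.1 hk).2) b).1]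
  by_cases hki : k = i
  · subst hki
    rw [Function.update_self]
    exact abs_gsCoeff_planeSteps_le hb ((pairwise_finRange_reverse d).filter _) _ (by simpa using hj)
  · rw [Function.update_of_ne hki]
    exact hk.resolve_left hki j hj

theorem sizeReduce_spec {d : ℕ} {b : Fin d → Fin d → ℚ} (hb : ∀ i, 0 < gsSq b i) :
    SameLattice b (sizeReduce b) ∧ ∀ k, RowReduced (sizeReduce b) k := by
  have key : ∀ (l : List (Fin d)) (b : Fin d → Fin d → ℚ), (∀ i, 0 < gsSq b i) →
      SameLattice b (l.foldl reduceRow b) ∧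
        ∀ k, k ∈ l ∨ RowReduced b k → RowReduced (l.foldl reduceRow b) k := by
    intro l
    induction l with
    | nil => exact fun b _ => ⟨⟨rfl, rfl⟩, fun k hk => hk.resolve_left (by simp)⟩
    | cons i l ih =>
      intro b hb
      have hs := sameLattice_reduceRow b i
      obtain ⟨h1, h2⟩ := ih (reduceRow b i) (by rwa [gsSq_congr hs.1])
      refine ⟨hs.trans h1, fun k hk => h2 k ?_⟩
      rw [List.mem_cons] at hk
      by_cases hkl : k ∈ l
      · exact Or.inl hkl
      · refine Or.inr (rowReduced_reduceRow hb i ?_)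
        tauto
  exact ⟨(key _ b hb).1, fun k => (key _ b hb).2 k (Or.inl (List.mem_finRange k))⟩

/-! ### Termination of LLL -/

/-- The product of the Gram determinants of the initial segments of a basis. -/
def potential {d : ℕ} (b : Fin d → Fin d → ℚ) : ℚ :=
  ∏ j, ∏ k ∈ Finset.Iic j, gsSq b k

theorem gsSq_swapNext_pos {d : ℕ} {b : Fin d → Fin d → ℚ} (hb : ∀ k, 0 < gsSq b k) (i k : Fin d) :
    0 < gsSq (swapNext b i) k := by
  by_cases h : (i : ℕ) + 1 < d
  · have hpos : 0 < gsSq (swapNext b i) i := by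
      rw [gsSq_swapNext_left b i h]
      have := hb i; have := hb ⟨i + 1, h⟩; positivity
    by_cases h1 : k = i
    · rwa [h1]
    by_cases h2 : k = ⟨i + 1, h⟩
    · have := gsSq_swapNext_right b i h hb
      rw [h2]
      refine pos_of_mul_pos_right (a := gsSq (swapNext b i) i) ?_ hpos.le
      rw [this]
      exact mul_pos (hb _) (hb _)
    · rw [gsSq, gramSchmidt_swapNext_of_ne b i h h1 h2]
      exact hb k
  · rw [swapNext, dif_neg h]
    exact hb k

/-- Only the Gram determinant of the segment ending at i changes: shorter segments contain neither
exchanged row, longer ones contain both. -/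
theorem potential_swapNext_le {d : ℕ} {b : Fin d → Fin d → ℚ} (hb : ∀ k, 0 < gsSq b k) {i : Fin d}
    (hi : LovaszFails b i) : potential (swapNext b i) ≤ 3 / 4 * potential b := by
  obtain ⟨h, hlov⟩ := hi
  have hlt : i < ⟨i + 1, h⟩ := by simp [Fin.lt_def]
  have hsame : ∀ k, k ≠ i → k ≠ ⟨i + 1, h⟩ → gsSq (swapNext b i) k = gsSq b k :=
    fun k h1 h2 => by rw [gsSq, gramSchmidt_swapNext_of_ne b i h h1 h2, gsSq]
  have hother : ∀ j, j ≠ i →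
      ∏ k ∈ Finset.Iic j, gsSq (swapNext b i) k = ∏ k ∈ Finset.Iic j, gsSq b k := by
    intro j hj
    rcases lt_or_gt_of_ne hj with hj | hj
    · refine Finset.prod_congr rfl fun k hk => ?_
      have hk' := (Finset.mem_Iic.1 hk).trans_lt hj
      exact hsame k hk'.ne (hk'.trans hlt).ne
    · have hsub : ({i, ⟨i + 1, h⟩} : Finset (Fin d)) ⊆ Finset.Iic j := by
        intro k hk
        rw [Fin.lt_def] at hj
        simp only [Finset.mem_insert, Finset.mem_singleton] at hk
        rcases hk with rfl | rfl
        · exact Finset.mem_Iic.2 (Fin.le_def.2 hj.le)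
        · exact Finset.mem_Iic.2 (Fin.le_def.2 hj)
      rw [← Finset.prod_sdiff hsub, ← Finset.prod_sdiff hsub, Finset.prod_pair hlt.ne,
        Finset.prod_pair hlt.ne, gsSq_swapNext_right b i h hb]
      congr 1
      refine Finset.prod_congr rfl fun k hk => ?_
      simp only [Finset.mem_sdiff, Finset.mem_insert, Finset.mem_singleton, not_or] at hk
      exact hsame k hk.2.1 hk.2.2
  have hithis : ∏ k ∈ Finset.Iic i, gsSq (swapNext b i) k ≤
      3 / 4 * ∏ k ∈ Finset.Iic i, gsSq b k := by
    have hI : Finset.Iic i = insert i (Finset.Iio i) := by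
      ext k; simp [le_iff_eq_or_lt]
    rw [hI, Finset.prod_insert (by simp), Finset.prod_insert (by simp), ← mul_assoc]
    have hP : ∏ k ∈ Finset.Iio i, gsSq (swapNext b i) k = ∏ k ∈ Finset.Iio i, gsSq b k := by
      refine Finset.prod_congr rfl fun k hk => ?_
      have hk' := Finset.mem_Iio.1 hk
      exact hsame k hk'.ne (hk'.trans hlt).ne
    rw [hP]
    refine mul_le_mul_of_nonneg_right ?_ (Finset.prod_nonneg fun k _ => (hb k).le)
    -- Failure of the Lovász condition says precisely that the new i-th squared length is below 3/4
    -- of the old one.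
    rw [gsSq_swapNext_left b i h]
    linarith
  unfold potential
  rw [← Finset.mul_prod_erase _ _ (Finset.mem_univ i),
    ← Finset.mul_prod_erase Finset.univ _ (Finset.mem_univ i), ← mul_assoc,
    Finset.prod_congr rfl fun j hj => hother j (Finset.ne_of_mem_erase hj)]
  exact mul_le_mul_of_nonneg_right hithis
    (Finset.prod_nonneg fun j _ => Finset.prod_nonneg fun k _ => (hb k).le)

/-- After scaling the rows by q, each Gram determinant is a positive integer, hence at least 1. -/
theorem le_potential {d : ℕ} {b : Fin d → Fin d → ℚ} (hb : ∀ k, 0 < gsSq b k) {q : ℕ} (hq : 0 < q)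
    (hint : ∀ i k, ∃ z : ℤ, (q : ℚ) * b i k = z) :
    ∏ j : Fin d, (1 / (q : ℚ) ^ 2) ^ (Finset.Iic j).card ≤ potential b := by
  have hq' : (0 : ℚ) < q := by exact_mod_cast hq
  refine Finset.prod_le_prod (fun _ _ => by positivity) fun j _ => ?_
  choose z hz using hint
  have hdet : ((Matrix.of fun k m : Finset.Iic j => dotProduct (z k) (z m)).det : ℚ) =
      ((q : ℚ) ^ 2) ^ (Finset.Iic j).card * ∏ k ∈ Finset.Iic j, gsSq b k := by
    rw [← det_gram_eq_prod_gsSq hb j, ← eq_intCast (Int.castRingHom ℚ), RingHom.map_det,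
      ← Fintype.card_coe (Finset.Iic j), ← Matrix.det_smul]
    congr 1
    ext k m
    simp only [RingHom.mapMatrix_apply, Matrix.map_apply, Matrix.of_apply, Matrix.smul_apply,
      dotProduct, smul_eq_mul, Finset.mul_sum, eq_intCast, Int.cast_sum, Int.cast_mul]
    refine Finset.sum_congr rfl fun l _ => ?_
    rw [← hz, ← hz]
    ring
  have hpos : 0 < ∏ k ∈ Finset.Iic j, gsSq b k := Finset.prod_pos fun k _ => hb k
  have h1 : (1 : ℚ) ≤ ((q : ℚ) ^ 2) ^ (Finset.Iic j).card * ∏ k ∈ Finset.Iic j, gsSq b k := by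
    have h0 : 0 < ((q : ℚ) ^ 2) ^ (Finset.Iic j).card * ∏ k ∈ Finset.Iic j, gsSq b k := by
      positivity
    rw [← hdet] at h0 ⊢
    exact_mod_cast Int.cast_pos.1 h0
  rw [one_div, inv_pow]
  exact inv_le_of_inv_le₀ hpos (by rwa [inv_le_iff_one_le_mul₀ hpos])

/-- LLL terminates on every basis `u` of a lattice with bounded denominators, and returns a reduced
basis of the same lattice. -/
theorem exists_mem_lll {d : ℕ} {u : Fin d → Fin d → ℚ} (hu : ∀ i, 0 < gsSq u i) {q : ℕ}
    (hq : 0 < q) (hint : ∀ i k, ∃ z : ℤ, (q : ℚ) * u i k = z) :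
    ∃ b ∈ lll u, (∀ i, 0 < gsSq b i) ∧
      Submodule.span ℤ (Set.range b) = Submodule.span ℤ (Set.range u) ∧
      ∀ (i : Fin d) (h : (i : ℕ) + 1 < d), gsSq b i ≤ 2 * gsSq b ⟨i + 1, h⟩ := by
  have hspan : ∀ b : Fin d → Fin d → ℚ,
      Submodule.span ℤ (Set.range b) = Submodule.span ℤ (Set.range u) →
      ∀ i k, ∃ z : ℤ, (q : ℚ) * b i k = z := by
    intro b hb i k
    have hmem : b i ∈ Submodule.span ℤ (Set.range u) := by
      rw [← hb]; exact Submodule.subset_span ⟨i, rfl⟩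
    generalize b i = x at hmem
    induction hmem using Submodule.span_induction with
    | mem x hx => obtain ⟨j, rfl⟩ := hx; exact hint j k
    | zero => exact ⟨0, by simp⟩
    | add x y _ _ hx hy =>
      obtain ⟨z, hz⟩ := hx; obtain ⟨w, hw⟩ := hy
      exact ⟨z + w, by rw [Pi.add_apply, mul_add, hz, hw]; push_cast; rfl⟩
    | smul c x _ hx =>
      obtain ⟨z, hz⟩ := hx
      refine ⟨c * z, ?_⟩
      rw [Pi.smul_apply, zsmul_eq_mul, mul_left_comm, hz]; push_cast; rfl
  have hsize : ∀ b : Fin d → Fin d → ℚ, (∀ i, 0 < gsSq b i) →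
      (∀ i, 0 < gsSq (sizeReduce b) i) := fun b hb => by
    rwa [gsSq_congr (sizeReduce_spec hb).1.1]
  have hfind : ∀ b : Fin d → Fin d → ℚ, (∃ i, LovaszFails b i) →
      ∃ i, LovaszFails b i ∧ lllStep b = sizeReduce (swapNext b i) := by
    rintro b ⟨i, hi⟩
    unfold lllStep
    split
    · next j hj => exact ⟨j, by simpa using List.find?_some hj, rfl⟩
    · next hnone =>
      rw [List.find?_eq_none] at hnone
      exact absurd hi (by simpa using hnone i (List.mem_finRange i))
  obtain ⟨b, hb, ⟨hpos, hsp, hred⟩, hlov⟩ := exists_mem_whileLoop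
    (cond := fun b : Fin d → Fin d → ℚ => ∃ i, LovaszFails b i) (step := lllStep)
    (s := sizeReduce u)
    (I := fun b => (∀ i, 0 < gsSq b i) ∧
      Submodule.span ℤ (Set.range b) = Submodule.span ℤ (Set.range u) ∧ ∀ k, RowReduced b k)
    (κ := ∏ j : Fin d, (1 / (q : ℚ) ^ 2) ^ (Finset.Iic j).card) (c := 3 / 4)
    (by
      rintro b ⟨h1, h2, -⟩ hc
      obtain ⟨i, -, hi⟩ := hfind b hc
      have h1' := gsSq_swapNext_pos h1 i
      rw [hi]
      refine ⟨hsize _ h1', ?_, (sizeReduce_spec h1').2⟩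
      rw [(sizeReduce_spec h1').1.2, span_range_swapNext, h2])
    ⟨hsize u hu, (sizeReduce_spec hu).1.2, (sizeReduce_spec hu).2⟩
    potential
    (Finset.prod_pos fun j _ => by
      have hq' : (0 : ℚ) < q := by exact_mod_cast hq
      positivity)
    (by norm_num) (by norm_num)
    (fun b hb _ => le_potential hb.1 hq (hspan b hb.2.1))
    (by
      rintro b ⟨h1, -, -⟩ hc
      obtain ⟨i, hlov, hi⟩ := hfind b hc
      have h1' := gsSq_swapNext_pos h1 i
      -- Size reduction preserves the Gram–Schmidt vectors, so only the exchange affects the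
      -- potential.
      refine le_of_eq_of_le ?_ (potential_swapNext_le h1 hlov)
      rw [hi, potential, gsSq_congr (sizeReduce_spec h1').1.1, potential])
  refine ⟨b, hb, hpos, hsp, fun i h => ?_⟩
  have h1 : ¬ LovaszFails b i := fun h' => hlov ⟨i, h'⟩
  have h2 : (3 / 4 - gsCoeff b (b ⟨i + 1, h⟩) i ^ 2) * gsSq b i ≤ gsSq b ⟨i + 1, h⟩ :=
    not_lt.1 fun h' => h1 ⟨h, h'⟩
  have h3 := hred ⟨i + 1, h⟩ i (by simp [Fin.lt_def])
  have h4 : gsCoeff b (b ⟨i + 1, h⟩) i ^ 2 ≤ 1 / 4 := by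
    have := sq_le_sq' (abs_le.1 h3).1 (abs_le.1 h3).2
    norm_num at this ⊢
    exact this
  -- The factor 2 comes from 3/4 - 1/4 = 1/2.
  nlinarith [hpos i]

/-! ### Nearest plane rounding -/

/-- All Gram–Schmidt coefficients of the final residue are at most 1/2 in absolute value; Pythagoras
does the rest. -/
theorem dotProduct_sub_nearestPlane_le {d : ℕ} {b : Fin d → Fin d → ℚ} (hb : ∀ i, 0 < gsSq b i)
    (c : Fin d → ℚ) :
    dotProduct (c - nearestPlane b c) (c - nearestPlane b c) ≤ 1 / 4 * ∑ i, gsSq b i := by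
  have h : c - nearestPlane b c = planeSteps b c (List.finRange d).reverse := by
    rw [nearestPlane, sub_sub_cancel]; rfl
  rw [h, dotProduct_eq_sum_gsCoeff hb, Finset.mul_sum]
  refine Finset.sum_le_sum fun j _ => ?_
  have h1 := abs_gsCoeff_planeSteps_le hb (pairwise_finRange_reverse d) c (j := j) (by simp)
  have h2 := sq_le_sq' (abs_le.1 h1).1 (abs_le.1 h1).2
  nlinarith [hb j]

theorem sum_gsSq_le {d : ℕ} {b : Fin d → Fin d → ℚ}
    (h : ∀ (i : Fin d) (h : (i : ℕ) + 1 < d), gsSq b i ≤ 2 * gsSq b ⟨i + 1, h⟩) {l : Fin d}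
    (hl : (l : ℕ) + 1 = d) : ∑ i, gsSq b i ≤ (2 ^ d - 1) * gsSq b l := by
  have key : ∀ n (i : Fin d), (i : ℕ) + 1 + n = d → gsSq b i ≤ 2 ^ n * gsSq b l := by
    intro n
    induction n with
    | zero =>
      intro i hi
      have : i = l := Fin.ext (by omega)
      rw [this, pow_zero, one_mul]
    | succ n ih =>
      intro i hi
      have h1 := h i (by omega)
      have h2 := ih ⟨i + 1, by omega⟩ (by simp only; omega)
      rw [pow_succ]
      linarith
  calc ∑ i, gsSq b i ≤ ∑ i : Fin d, (2 : ℚ) ^ (d - 1 - (i : ℕ)) * gsSq b l :=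
        Finset.sum_le_sum fun i _ => key _ i (by omega)
    _ = (2 ^ d - 1) * gsSq b l := by
        rw [← Finset.sum_mul, Fin.sum_univ_eq_sum_range (fun i => (2 : ℚ) ^ (d - 1 - i)) d,
          Finset.sum_range_reflect (fun i => (2 : ℚ) ^ i) d, geom_sum_eq (by norm_num)]
        norm_num

/-! ### The binary search -/

/-- Every coordinate of c(r) is at distance r from its constraint. Strictness of ρ < r is needed for
the open condition on the last coordinate. -/
theorem inRegion_of_dotProduct_le {d : ℕ} {ρ : ℝ} (hρ : 0 ≤ ρ) {r : ℚ} (hr : ρ < r)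
    {x : Fin d → ℚ}
    (hx : ((dotProduct (center d r - x) (center d r - x) : ℚ) : ℝ) ≤ ρ ^ 2) : InRegion x := by
  intro i
  have h1 : (center d r i - x i) ^ 2 ≤ dotProduct (center d r - x) (center d r - x) := by
    rw [sq]
    exact Finset.single_le_sum (f := fun k => (center d r - x) k * (center d r - x) k)
      (fun k _ => mul_self_nonneg _) (Finset.mem_univ i)
  have h2 : (((center d r i - x i : ℚ) : ℝ)) ^ 2 ≤ ρ ^ 2 := by
    refine le_trans ?_ hx
    exact_mod_cast h1
  have h3 := abs_le.1 (abs_le_of_sq_le_sq h2 hρ)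
  have h4 : -r < center d r i - x i := by
    have : -(r : ℝ) < ((center d r i - x i : ℚ) : ℝ) := by linarith
    exact_mod_cast this
  have h5 : center d r i - x i < r := by
    have : ((center d r i - x i : ℚ) : ℝ) < r := by linarith
    exact_mod_cast this
  unfold center at h4 h5
  split_ifs at h4 h5 ⊢ <;> linarith

/-- If nearest plane rounding has error at most `ρ`, then the binary search terminates with a point
of the region that is within `ρ` of a center `c (r)`, where `r ≤ ρ + ε`. -/
theorem exists_mem_search {d : ℕ} {b : Fin d → Fin d → ℚ} {ρ : ℝ} (hρ : 0 ≤ ρ)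
    (hb : ∀ c, ((dotProduct (c - nearestPlane b c) (c - nearestPlane b c) : ℚ) : ℝ) ≤ ρ ^ 2)
    {ε : ℚ} (hε : 0 < ε) :
    ∃ s ∈ whileLoop (fun s : SearchState d => ε < s.hi - s.lo) (searchStep b) ⟨0, 1, center d 1⟩,
      0 ≤ s.hi ∧ s.hi ≤ 1 ∧ (s.hi : ℝ) ≤ ρ + ε ∧ InRegion s.pt ∧
      ((dotProduct (center d s.hi - s.pt) (center d s.hi - s.pt) : ℚ) : ℝ) ≤ ρ ^ 2 := by
  obtain ⟨s, hs, ⟨h1, h2, h3, h4, h5, h6⟩, hc⟩ := exists_mem_whileLoop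
    (cond := fun s : SearchState d => ε < s.hi - s.lo) (step := searchStep b)
    (s := ⟨0, 1, center d 1⟩)
    -- Success need not be monotone in r. It suffices that the lower end is zero or a failed radius,
    -- hence at most ρ, and that the stored point stays near the center of the upper end.
    (I := fun s => 0 ≤ s.lo ∧ s.lo ≤ s.hi ∧ s.hi ≤ 1 ∧ (s.lo : ℝ) ≤ ρ ∧ InRegion s.pt ∧
      ((dotProduct (center d s.hi - s.pt) (center d s.hi - s.pt) : ℚ) : ℝ) ≤ ρ ^ 2)
    (by
      rintro ⟨lo, hi, pt⟩ ⟨h1, h2, h3, h4, h5, h6⟩ hc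
      simp only at h1 h2 h3 h4 h5 h6 hc
      unfold searchStep
      split_ifs with hr
      · exact ⟨h1, by simp only; linarith, by simp only; linarith, h4, hr, hb _⟩
      · refine ⟨by simp only; linarith, by simp only; linarith, h3, ?_, h5, h6⟩
        exact not_lt.1 fun hlt => hr (inRegion_of_dotProduct_le hρ hlt (hb _)))
    -- Initially the stored point is c(1) itself, at distance 0 from the center and inside the
    -- region.
    ⟨le_rfl, by norm_num, le_rfl, by simpa using hρ,
      fun i => by by_cases hi : (i : ℕ) + 1 = d <;> simp [center, hi],
      by simpa using sq_nonneg ρ⟩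
    (fun s => s.hi - s.lo) hε (by norm_num : (0 : ℚ) ≤ 1 / 2) (by norm_num)
    (fun s _ hc => le_of_lt hc)
    (by
      rintro ⟨lo, hi, pt⟩ - -
      unfold searchStep
      split_ifs <;> simp only <;> linarith)
  refine ⟨s, hs, h1.trans h2, h3, ?_, h5, h6⟩
  have : (s.hi : ℝ) - s.lo ≤ ε := by exact_mod_cast not_lt.1 hc
  linarith

/-! ### The norm of the additive problem -/

theorem norm_toReal_sq {d : ℕ} (x : Fin d → ℚ) : ‖toReal x‖ ^ 2 = ((dotProduct x x : ℚ) : ℝ) := by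
  rw [EuclideanSpace.norm_sq_eq]
  simp only [toReal, Real.norm_eq_abs, sq_abs, dotProduct]
  push_cast
  exact Finset.sum_congr rfl fun i _ => sq _

theorem norm_toReal_le_norm_toReal {d : ℕ} {x y : Fin d → ℚ} (h : ∀ i, |x i| ≤ |y i|) :
    ‖toReal x‖ ≤ ‖toReal y‖ := by
  refine (abs_le_of_sq_le_sq' ?_ (norm_nonneg _)).2
  rw [norm_toReal_sq, norm_toReal_sq, Rat.cast_le]
  exact Finset.sum_le_sum fun i _ => by
    rw [← abs_mul_abs_self (x i), ← abs_mul_abs_self (y i)]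
    exact mul_self_le_mul_self (abs_nonneg _) (h i)

theorem norm_toReal_const {d : ℕ} {r : ℚ} (hr : 0 ≤ r) :
    ‖toReal (fun _ : Fin d => r)‖ = Real.sqrt d * r := by
  rw [← Real.sqrt_sq (norm_nonneg _), norm_toReal_sq]
  have hr' : (0 : ℝ) ≤ r := by exact_mod_cast hr
  simp only [dotProduct, Finset.sum_const, Finset.card_univ, Fintype.card_fin, nsmul_eq_mul]
  push_cast
  rw [Real.sqrt_mul (by positivity), Real.sqrt_mul_self hr']

/-- The reflection `(x_1, …, x_{d-1}, 1 - x_d)`. -/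
def flipLast {d : ℕ} (x : Fin d → ℚ) : Fin d → ℚ :=
  fun i => if (i : ℕ) + 1 = d then 1 - x i else x i

theorem N_eq {d : ℕ} (x : Fin d → ℚ) : N x = ‖toReal (flipLast x)‖ := rfl

/-- In the region, reduction modulo 1 lowers nonnegative coordinates towards 0 and can only raise
the last one, which stays below 1. -/
theorem N_modOne_le {d : ℕ} {x : Fin d → ℚ} (hx : InRegion x) : N (modOne x) ≤ N x := by
  refine norm_toReal_le_norm_toReal fun i => ?_
  have h := hx i
  have h0 := Int.fract_nonneg (x i)
  have h1 := Int.fract_lt_one (x i)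
  unfold modOne
  split_ifs with hi
  · rw [if_pos hi] at h
    rw [abs_of_pos (by linarith), abs_of_pos (by linarith)]
    have : (⌊x i⌋ : ℚ) ≤ 0 := by
      have : ⌊x i⌋ < 1 := Int.floor_lt.2 (by exact_mod_cast h)
      exact_mod_cast Int.lt_add_one_iff.1 this
    rw [Int.fract]
    linarith
  · rw [if_neg hi] at h
    rw [abs_of_nonneg h0, abs_of_nonneg h, Int.fract]
    have : (0 : ℚ) ≤ ⌊x i⌋ := by exact_mod_cast Int.floor_nonneg.2 h
    linarith

theorem norm_flipLast_sub_sq {d : ℕ} (x : Fin d → ℚ) (r : ℚ) :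
    dotProduct (flipLast x - fun _ => r) (flipLast x - fun _ => r) =
      dotProduct (center d r - x) (center d r - x) := by
  refine Finset.sum_congr rfl fun i _ => ?_
  simp only [Pi.sub_apply, flipLast, center]
  split_ifs <;> ring

theorem N_le_of_dotProduct_le {d : ℕ} {ρ : ℝ} (hρ : 0 ≤ ρ) {r : ℚ} (hr : 0 ≤ r) {x : Fin d → ℚ}
    (hx : ((dotProduct (center d r - x) (center d r - x) : ℚ) : ℝ) ≤ ρ ^ 2) :
    N x ≤ ρ + Real.sqrt d * r := by
  have h1 : ‖toReal (flipLast x - fun _ => r)‖ ≤ ρ := by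
    refine (abs_le_of_sq_le_sq' ?_ hρ).2
    rwa [norm_toReal_sq, norm_flipLast_sub_sq]
  have h2 : toReal (flipLast x) = toReal (flipLast x - fun _ => r) + toReal (fun _ => r) := by
    ext i
    simp [toReal]
  rw [N_eq, h2, ← norm_toReal_const hr]
  exact (norm_add_le _ _).trans (by linarith)

theorem N_le_sqrt {d : ℕ} {x : Fin d → ℚ} (h0 : ∀ i, 0 ≤ x i) (h1 : ∀ i, x i ≤ 1) :
    N x ≤ Real.sqrt d := by
  have h := norm_toReal_const (d := d) zero_le_one
  rw [Rat.cast_one, mul_one] at h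
  rw [← h]
  refine norm_toReal_le_norm_toReal fun i => ?_
  have := h0 i
  have := h1 i
  rw [abs_one, abs_le]
  split_ifs <;> constructor <;> linarith

/-- A vector with an entry `0`, an entry at least `1` and all other entries either `0` or at least
`1` is not close to a multiple `r ≤ 1` of the all-ones vector. -/
theorem le_dotProduct_sub_const {d : ℕ} {y : Fin d → ℚ} (hy : ∀ i, y i = 0 ∨ 1 ≤ y i) {i l : Fin d}
    (hi : y i = 0) (hl : 1 ≤ y l) {r : ℚ} (hr : r ≤ 1) :
    ((d : ℚ) - 1) / d ≤ dotProduct (y - fun _ => r) (y - fun _ => r) := by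
  have hil : i ≠ l := fun h => by rw [h] at hi; linarith
  have hd : (0 : ℚ) < d := by exact_mod_cast i.pos
  have hd2 : 2 ≤ d := by
    have := Finset.card_le_univ ({i, l} : Finset (Fin d))
    rwa [Finset.card_pair hil, Fintype.card_fin] at this
  have hd2' : (2 : ℚ) ≤ d := by exact_mod_cast hd2
  have hsplit : dotProduct (y - fun _ => r) (y - fun _ => r) =
      ∑ k ∈ Finset.univ \ {i, l}, (y k - r) * (y k - r) +
        ((y i - r) * (y i - r) + (y l - r) * (y l - r)) := by
    rw [← Finset.sum_pair (f := fun k => (y k - r) * (y k - r)) hil,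
      Finset.sum_sdiff (Finset.subset_univ _)]
    rfl
  have hcard : ((Finset.univ \ {i, l} : Finset (Fin d)).card : ℚ) = d - 2 := by
    rw [Finset.card_sdiff_of_subset (Finset.subset_univ _), Finset.card_pair hil, Finset.card_univ,
      Fintype.card_fin, Nat.cast_sub hd2]
    rfl
  have hone : ∀ k, 1 ≤ y k → (1 - r) ^ 2 ≤ (y k - r) * (y k - r) := fun k hk => by nlinarith
  -- Entries 0 and entries at least 1 contribute at least r² and (1 - r)²; m is a common lower bound
  -- for the d - 2 unspecified entries.
  have hmin : ∀ m : ℚ, m ≤ r ^ 2 → m ≤ (1 - r) ^ 2 →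
      (d - 2) * m + (r ^ 2 + (1 - r) ^ 2) ≤ dotProduct (y - fun _ => r) (y - fun _ => r) := by
    intro m h1 h2
    rw [hsplit, hi, ← hcard, ← nsmul_eq_mul]
    refine add_le_add (Finset.card_nsmul_le_sum _ _ _ fun k _ => ?_)
      (add_le_add (by linarith) (hone l hl))
    rcases hy k with hk | hk
    · rw [hk]; linarith
    · exact h2.trans (hone k hk)
  rw [div_le_iff₀ hd]
  -- The resulting quadratic, (d - 1)r² + (1 - r)² or its mirror image, has minimum (d - 1)/d, at r
  -- = 1/d or r = 1 - 1/d; the hints complete the square.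
  rcases le_total (r ^ 2) ((1 - r) ^ 2) with h | h
  · have := mul_le_mul_of_nonneg_right (hmin (r ^ 2) le_rfl h) hd.le
    nlinarith [sq_nonneg ((d : ℚ) * r - 1)]
  · have := mul_le_mul_of_nonneg_right (hmin ((1 - r) ^ 2) h le_rfl) hd.le
    nlinarith [sq_nonneg ((d : ℚ) * (1 - r) - 1)]

/-- Since (1 + √d)² ≥ d + 3, it is enough that (d + 3)(d - 1) ≥ d², which holds for d ≥ 2. -/
theorem sqrt_le_one_add_sqrt_mul {d : ℕ} (hd : 2 ≤ d) {ρ : ℝ} (hρ : 0 ≤ ρ)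
    (h : ((d : ℝ) - 1) / d ≤ ρ ^ 2) : Real.sqrt d ≤ (1 + Real.sqrt d) * ρ := by
  have hd' : (2 : ℝ) ≤ d := by exact_mod_cast hd
  have hs : Real.sqrt d ^ 2 = d := Real.sq_sqrt (by linarith)
  have hs1 : 1 ≤ Real.sqrt d := Real.one_le_sqrt.2 (by linarith)
  refine (abs_le_of_sq_le_sq' ?_ (by positivity)).2
  rw [div_le_iff₀ (by linarith)] at h
  rw [mul_pow]
  have h1 : (3 + d : ℝ) ≤ (1 + Real.sqrt d) ^ 2 := by nlinarith
  have h2 : (3 + d : ℝ) * ρ ^ 2 ≤ (1 + Real.sqrt d) ^ 2 * ρ ^ 2 :=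
    mul_le_mul_of_nonneg_right h1 (sq_nonneg _)
  refine le_trans ?_ h2
  rw [hs]
  refine le_of_mul_le_mul_right ?_ (show (0 : ℝ) < d by linarith)
  nlinarith

/-- The quality of the value that the additive algorithm extracts from the point found. -/
theorem N_output_le {d : ℕ} (hd : 2 ≤ d) {ν ξ : Fin d → ℚ} (h0 : ∀ i, 0 ≤ ν i)
    (h1 : ∀ i, ν i ≤ 1) {ρ : ℝ} (hρ : 0 ≤ ρ) {ε r : ℚ} (hε : 0 ≤ ε) (hr0 : 0 ≤ r) (hr1 : r ≤ 1)
    (hrρ : (r : ℝ) ≤ ρ + ε) (hreg : InRegion ξ)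
    (hξ : ((dotProduct (center d r - ξ) (center d r - ξ) : ℚ) : ℝ) ≤ ρ ^ 2) :
    N (if modOne ξ = 0 then ν else modOne ξ) ≤ (1 + Real.sqrt d) * ρ + Real.sqrt d * ε := by
  have hN : N ξ ≤ (1 + Real.sqrt d) * ρ + Real.sqrt d * ε := by
    have h2 := N_le_of_dotProduct_le hρ hr0 hξ
    have h3 := mul_le_mul_of_nonneg_left hrρ (Real.sqrt_nonneg d)
    linarith
  split_ifs with hint
  · have hε' : 0 ≤ Real.sqrt d * (ε : ℝ) := mul_nonneg (Real.sqrt_nonneg _) (by exact_mod_cast hε)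
    have hy : ∀ i, flipLast ξ i = 0 ∨ 1 ≤ flipLast ξ i := by
      intro i
      have h2 := hreg i
      have h3 : ξ i = ⌊ξ i⌋ := by
        have h4 : Int.fract (ξ i) = 0 := congrFun hint i
        rw [Int.fract] at h4
        linarith
      rw [h3] at h2
      unfold flipLast
      rw [h3]
      split_ifs at h2 ⊢
      · right
        have h4 : ⌊ξ i⌋ < 1 := by exact_mod_cast h2
        have h5 : (⌊ξ i⌋ : ℚ) ≤ 0 := by exact_mod_cast Int.lt_add_one_iff.1 h4
        linarith
      · have h4 : 0 ≤ ⌊ξ i⌋ := by exact_mod_cast h2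
        rcases h4.eq_or_lt with h5 | h5
        · left; rw [← h5]; rfl
        · right; exact_mod_cast h5
    refine (N_le_sqrt h0 h1).trans ?_
    -- If all flipped entries are at least 1, then N(ξ) is itself at least √d. Otherwise some entry
    -- is 0 while the last is at least 1, which forces ρ to be large.
    by_cases hall : ∀ i, 1 ≤ flipLast ξ i
    · refine le_trans ?_ hN
      have h := norm_toReal_const (d := d) zero_le_one
      rw [Rat.cast_one, mul_one] at h
      rw [← h, N_eq]
      refine norm_toReal_le_norm_toReal fun i => ?_
      rw [abs_one]
      exact (hall i).trans (le_abs_self _)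
    · push Not at hall
      obtain ⟨i, hi⟩ := hall
      have hi0 : flipLast ξ i = 0 := (hy i).resolve_right (not_le.2 hi)
      have hl : 1 ≤ flipLast ξ ⟨d - 1, by omega⟩ := by
        have h2 := hreg ⟨d - 1, by omega⟩
        refine (hy ⟨d - 1, by omega⟩).resolve_left fun h3 => ?_
        have hlast : d - 1 + 1 = d := by omega
        simp only [flipLast, hlast, if_true] at h2 h3
        linarith
      have h2 := le_dotProduct_sub_const hy hi0 hl hr1
      rw [norm_flipLast_sub_sq] at h2
      have h3 : ((d : ℝ) - 1) / d ≤ ρ ^ 2 := le_trans (by exact_mod_cast h2) hξ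
      linarith [sqrt_le_one_add_sqrt_mul hd hρ h3]
  · exact (N_modOne_le hreg).trans hN

/-! ### Coverings of Euclidean space by lattice translates -/

open MeasureTheory in
/-- A set whose translates by `ℤ^d` cover the space has volume at least `1`. -/
theorem one_le_volume_of_cover {d : ℕ} {S : Set (E d)}
    (h : ∀ x : E d, ∃ z ∈ Submodule.span ℤ
      (Set.range fun i : Fin d => (EuclideanSpace.single i (1 : ℝ) : E d)), ∃ s ∈ S, x = z + s) :
    1 ≤ volume S := by
  set b := (EuclideanSpace.basisFun (Fin d) ℝ).toBasis with hb
  have hrange : Set.range b = Set.range fun i : Fin d => (EuclideanSpace.single i (1 : ℝ) : E d) := by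
    congr 1
    funext i
    simp [hb]
  have hF := ZSpan.isAddFundamentalDomain b (volume : Measure (E d))
  have hvol : volume (ZSpan.fundamentalDomain b) = 1 := by
    rw [measure_congr (ZSpan.fundamentalDomain_ae_parallelepiped b volume), hb,
      OrthonormalBasis.coe_toBasis, OrthonormalBasis.volume_parallelepiped]
  have : VAddInvariantMeasure (Submodule.span ℤ (Set.range b)) (E d) volume :=
    inferInstanceAs <| VAddInvariantMeasure (Submodule.span ℤ (Set.range b)).toAddSubgroup (E d) volume
  -- Cutting S along the translates of the unit cell and moving the pieces into the cell fills it,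
  -- by the covering hypothesis.
  rw [← hvol, hF.measure_eq_tsum S]
  refine (measure_mono ?_).trans (measure_iUnion_le _)
  intro x hx
  obtain ⟨z, hz, s, hs, rfl⟩ := h x
  rw [← hrange] at hz
  exact Set.mem_iUnion.2 ⟨⟨z, hz⟩, ⟨s, hs, rfl⟩, hx⟩

open MeasureTheory in
theorem volume_orthonormal_box {d : ℕ} (o : OrthonormalBasis (Fin d) ℝ (E d)) (s : Fin d → Set ℝ)
    (hs : ∀ i, MeasurableSet (s i)) :
    volume {x : E d | ∀ i, o.repr x i ∈ s i} = ∏ i, volume (s i) := by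
  have h1 : {x : E d | ∀ i, o.repr x i ∈ s i} =
      o.repr ⁻¹' (@WithLp.ofLp 2 (Fin d → ℝ) ⁻¹' Set.univ.pi s) := by
    ext x; simp
  have hm : MeasurableSet (Set.univ.pi s) := MeasurableSet.univ_pi hs
  rw [h1, o.measurePreserving_repr.measure_preimage
      ((PiLp.volume_preserving_ofLp (Fin d)).measurable hm).nullMeasurableSet,
    (PiLp.volume_preserving_ofLp (Fin d)).measure_preimage hm.nullMeasurableSet, volume_pi_pi]

theorem exists_orthonormalBasis_smul {d : ℕ} (i₀ : Fin d) {y : E d} (hy : y ≠ 0) :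
    ∃ o : OrthonormalBasis (Fin d) ℝ (E d), ‖y‖ • o i₀ = y := by
  have hn : ‖y‖ ≠ 0 := norm_ne_zero_iff.2 hy
  obtain ⟨o, ho⟩ := Orthonormal.exists_orthonormalBasis_extension_of_card_eq (𝕜 := ℝ) (E := E d)
    (ι := Fin d) (by simp) (v := fun _ => ‖y‖⁻¹ • y) (s := {i₀}) (by
      constructor
      · intro i
        simp [Set.domRestrict, norm_smul, hn]
      · intro i j hij
        exact absurd (Subsingleton.elim i j) hij)
  refine ⟨o, ?_⟩
  rw [ho i₀ rfl, smul_smul, mul_inv_cancel₀ hn, one_smul]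

/-- As qν is integral, multiples of ν matter only modulo q. The factor q in the volume bound
originates here. -/
theorem exists_eq_add_of_mem_iterLattice {d q : ℕ} (hq : 0 < q) (p : Fin d → ℕ) {x : E d}
    (hx : x ∈ iterLattice (nuVec p q)) :
    ∃ z ∈ Submodule.span ℤ (Set.range fun i : Fin d => (EuclideanSpace.single i (1 : ℝ) : E d)),
      ∃ t : Fin q, x = z + ((t : ℕ) : ℝ) • toReal (nuVec p q) := by
  obtain ⟨z, hz, w, hw, rfl⟩ := Submodule.mem_sup.1 hx
  obtain ⟨n, rfl⟩ := Submodule.mem_span_singleton.1 hw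
  have hq' : (q : ℤ) ≠ 0 := by exact_mod_cast hq.ne'
  have hqR : (q : ℝ) ≠ 0 := by exact_mod_cast hq.ne'
  have hqν : (q : ℝ) • toReal (nuVec p q) ∈
      Submodule.span ℤ (Set.range fun i : Fin d => (EuclideanSpace.single i (1 : ℝ) : E d)) := by
    have h : (q : ℝ) • toReal (nuVec p q) =
        ∑ i, (p i : ℤ) • (EuclideanSpace.single i (1 : ℝ) : E d) := by
      ext k
      simp [toReal, nuVec, Finset.sum_apply, Pi.single_apply]
      field_simp
    rw [h]
    exact Submodule.sum_mem _ fun i _ => Submodule.smul_mem _ _ (Submodule.subset_span ⟨i, rfl⟩)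
  have hlt : (n % q).toNat < q := by
    have h1 := Int.emod_lt_of_pos n (show (0 : ℤ) < q by exact_mod_cast hq)
    have h2 := Int.emod_nonneg n hq'
    omega
  refine ⟨z + (n / q) • ((q : ℝ) • toReal (nuVec p q)), add_mem hz (Submodule.smul_mem _ _ hqν),
    ⟨(n % q).toNat, hlt⟩, ?_⟩
  have h2 : (((n % q).toNat : ℕ) : ℝ) = ((n % q : ℤ) : ℝ) := by
    exact_mod_cast congrArg (Int.cast : ℤ → ℝ) (Int.toNat_of_nonneg (Int.emod_nonneg n hq'))
  have h3 : (n : ℝ) = ((n / q : ℤ) : ℝ) * q + ((n % q : ℤ) : ℝ) := by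
    exact_mod_cast (Int.ediv_mul_add_emod n q).symm
  simp only [h2]
  rw [add_assoc, ← Int.cast_smul_eq_zsmul ℝ n, ← Int.cast_smul_eq_zsmul ℝ (n / q), smul_smul,
    ← add_smul, ← h3]

open MeasureTheory in
/-- If balls of radius `σ` around the points of `ℤ^d + ℤ ν` cover the space, then every nonzero
vector `y` of this lattice satisfies `1 ≤ q ‖y‖ (2σ)^(d-1)`. -/
theorem one_le_of_cover {d q : ℕ} (hd : 0 < d) (hq : 0 < q) (p : Fin d → ℕ) {σ : ℝ} (hσ : 0 ≤ σ)
    (hcov : ∀ x : E d, ∃ l ∈ iterLattice (nuVec p q), ‖x - l‖ ≤ σ) {y : E d} (hy : y ≠ 0)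
    (hyL : y ∈ iterLattice (nuVec p q)) : 1 ≤ (q : ℝ) * ‖y‖ * (2 * σ) ^ (d - 1) := by
  obtain ⟨o, ho⟩ := exists_orthonormalBasis_smul (⟨0, hd⟩ : Fin d) hy
  set i₀ : Fin d := ⟨0, hd⟩
  have hn : 0 < ‖y‖ := norm_pos_iff.2 hy
  set s : Fin d → Set ℝ := fun i => if i = i₀ then Set.Ico 0 ‖y‖ else Set.Icc (-σ) σ with hs
  have hsm : ∀ i, MeasurableSet (s i) := fun i => by
    simp only [hs]; split_ifs <;> measurability
  set B : Set (E d) := {x | ∀ i, o.repr x i ∈ s i}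
  have hB : volume B = ENNReal.ofReal (‖y‖ * (2 * σ) ^ (d - 1)) := by
    rw [volume_orthonormal_box o s hsm, ← Finset.mul_prod_erase _ _ (Finset.mem_univ i₀),
      Finset.prod_congr rfl (g := fun _ => ENNReal.ofReal (2 * σ)) fun i hi => by
        simp only [hs, if_neg (Finset.ne_of_mem_erase hi), Real.volume_Icc]; congr 1; ring,
      Finset.prod_const, Finset.card_erase_of_mem (Finset.mem_univ _), Finset.card_univ,
      Fintype.card_fin, ENNReal.ofReal_mul hn.le, ENNReal.ofReal_pow (by positivity)]
    simp [hs]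
  have hcover : ∀ x : E d, ∃ l ∈ iterLattice (nuVec p q), x - l ∈ B := by
    intro x
    obtain ⟨l, hl, hxl⟩ := hcov x
    set a := o.repr (x - l) i₀
    -- A multiple of y brings the coordinate along y into [0, ‖y‖) and leaves the orthogonal
    -- coordinates, already bounded by σ, unchanged.
    refine ⟨l + ⌊a / ‖y‖⌋ • y, add_mem hl (Submodule.smul_mem _ _ hyL), fun i => ?_⟩
    have hrepr : o.repr (x - (l + ⌊a / ‖y‖⌋ • y)) i =
        o.repr (x - l) i - if i = i₀ then (⌊a / ‖y‖⌋ : ℝ) * ‖y‖ else 0 := by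
      rw [← sub_sub, ← Int.cast_smul_eq_zsmul ℝ, map_sub, map_smul]
      conv_lhs => rw [← ho]
      rw [map_smul, o.repr_self]
      simp [norm_smul]
    rw [hrepr]
    by_cases hi : i = i₀
    · subst hi
      simp only [hs, if_true]
      have h1 := Int.floor_le (a / ‖y‖)
      have h2 := Int.lt_floor_add_one (a / ‖y‖)
      rw [le_div_iff₀ hn] at h1
      rw [div_lt_iff₀ hn] at h2
      exact ⟨by linarith, by linarith⟩
    · simp only [hs, if_neg hi, sub_zero]
      have h1 : ‖o.repr (x - l) i‖ ≤ ‖o.repr (x - l)‖ := PiLp.norm_apply_le _ _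
      rw [LinearIsometryEquiv.norm_map, Real.norm_eq_abs] at h1
      exact abs_le.1 (h1.trans hxl)
  have h1 : 1 ≤ volume (⋃ t : Fin q, (((t : ℕ) : ℝ) • toReal (nuVec p q)) +ᵥ B) := by
    refine one_le_volume_of_cover fun x => ?_
    obtain ⟨l, hl, hx⟩ := hcover x
    obtain ⟨z, hz, t, rfl⟩ := exists_eq_add_of_mem_iterLattice hq p hl
    refine ⟨z, hz, x - z, Set.mem_iUnion.2 ⟨t, _, hx, ?_⟩, by abel⟩
    simp only [vadd_eq_add]
    abel
  have h2 : volume (⋃ t : Fin q, (((t : ℕ) : ℝ) • toReal (nuVec p q)) +ᵥ B) ≤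
      ENNReal.ofReal ((q : ℝ) * ‖y‖ * (2 * σ) ^ (d - 1)) := by
    refine (measure_iUnion_le _).trans ?_
    simp only [measure_vadd, hB, tsum_fintype, Finset.sum_const, Finset.card_univ,
      Fintype.card_fin, nsmul_eq_mul]
    rw [mul_assoc, ENNReal.ofReal_mul (Nat.cast_nonneg q), ENNReal.ofReal_natCast]
  exact ENNReal.one_le_ofReal.1 (h1.trans h2)

/-! ### The covering radius -/

theorem span_iterLattice {d : ℕ} (ν : Fin d → ℚ) :
    Submodule.span ℝ (iterLattice ν : Set (E d)) = ⊤ := by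
  refine top_unique ?_
  rw [← (EuclideanSpace.basisFun (Fin d) ℝ).toBasis.span_eq, Submodule.span_le]
  rintro _ ⟨i, rfl⟩
  refine Submodule.subset_span (Submodule.mem_sup_left (Submodule.subset_span ⟨i, ?_⟩))
  simp

/-- The radii of the balls whose translates by the lattice cover the space. -/
def coverRadii {d : ℕ} (ν : Fin d → ℚ) : Set ℝ :=
  {σ : ℝ | 0 < σ ∧ ∀ x : E d, ∃ l ∈ iterLattice ν, ‖x - l‖ ≤ σ}

theorem coveringRadius_eq {d : ℕ} (ν : Fin d → ℚ) :
    coveringRadius (iterLattice ν) = sInf (coverRadii ν) := by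
  rw [coveringRadius, inhomMin, span_iterLattice]
  congr 1
  ext σ
  simp only [coverRadii, Submodule.top_coe, Set.inter_univ, Set.mem_ofPred_eq]
  refine and_congr_right fun hσ => ?_
  rw [smul_closedBall _ _ zero_le_one, smul_zero, Real.norm_of_nonneg hσ.le, mul_one,
    Set.eq_univ_iff_forall]
  refine forall_congr' fun x => ?_
  rw [Set.mem_add]
  constructor
  · rintro ⟨l, hl, y, hy, rfl⟩
    exact ⟨l, hl, by simpa using hy⟩
  · rintro ⟨l, hl, h⟩
    exact ⟨l, hl, x - l, by simpa using h, by abel⟩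

theorem coverRadii_nonempty {d : ℕ} (ν : Fin d → ℚ) : (coverRadii ν).Nonempty := by
  refine ⟨Real.sqrt d + 1, by positivity, fun x => ?_⟩
  refine ⟨∑ i, ⌊x i⌋ • (EuclideanSpace.single i (1 : ℝ) : E d), Submodule.mem_sup_left
    (Submodule.sum_mem _ fun i _ => Submodule.smul_mem _ _ (Submodule.subset_span ⟨i, rfl⟩)), ?_⟩
  refine le_trans ?_ (le_add_of_nonneg_right zero_le_one)
  rw [EuclideanSpace.norm_eq]
  refine Real.sqrt_le_sqrt ?_
  have h : ∀ i, ‖(x - ∑ i, ⌊x i⌋ • (EuclideanSpace.single i (1 : ℝ) : E d)) i‖ ^ 2 ≤ 1 := by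
    intro i
    have h1 : (x - ∑ i, ⌊x i⌋ • (EuclideanSpace.single i (1 : ℝ) : E d)) i = Int.fract (x i) := by
      simp [Finset.sum_apply, Pi.single_apply]
    rw [h1, Real.norm_of_nonneg (Int.fract_nonneg _)]
    exact pow_le_one₀ (Int.fract_nonneg _) (Int.fract_lt_one _).le
  calc _ ≤ ∑ _i : Fin d, (1 : ℝ) := Finset.sum_le_sum fun i _ => h i
    _ = d := by simp

theorem coveringRadius_nonneg {d : ℕ} (ν : Fin d → ℚ) : 0 ≤ coveringRadius (iterLattice ν) := by
  rw [coveringRadius_eq]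
  exact Real.sInf_nonneg fun σ hσ => hσ.1.le

/-- The inequality is a closed condition on σ, so it passes to the infimum without showing that the
infimum is attained. -/
theorem one_le_mul_coveringRadius {d q : ℕ} (hd : 0 < d) (hq : 0 < q) (p : Fin d → ℕ) {y : E d}
    (hy : y ≠ 0) (hyL : y ∈ iterLattice (nuVec p q)) :
    1 ≤ (q : ℝ) * ‖y‖ * (2 * coveringRadius (iterLattice (nuVec p q))) ^ (d - 1) := by
  have hcl : coveringRadius (iterLattice (nuVec p q)) ∈ closure (coverRadii (nuVec p q)) := by
    rw [coveringRadius_eq]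
    exact csInf_mem_closure (coverRadii_nonempty _) ⟨0, fun σ hσ => hσ.1.le⟩
  have hclosed : IsClosed {σ : ℝ | 1 ≤ (q : ℝ) * ‖y‖ * (2 * σ) ^ (d - 1)} :=
    isClosed_le continuous_const (by fun_prop)
  exact closure_minimal (fun σ hσ => one_le_of_cover hd hq p hσ.1.le hσ.2 hy hyL) hclosed hcl

theorem inner_toReal {d : ℕ} (x y : Fin d → ℚ) :
    inner ℝ (toReal x) (toReal y) = ((dotProduct x y : ℚ) : ℝ) := by
  simp [toReal, dotProduct, PiLp.inner_apply, mul_comm]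

theorem toReal_add {d : ℕ} (x y : Fin d → ℚ) : toReal (x + y) = toReal x + toReal y := by
  ext i; simp [toReal]

theorem toReal_zsmul {d : ℕ} (c : ℤ) (x : Fin d → ℚ) : toReal (c • x) = c • toReal x := by
  ext i; simp [toReal]

/-- The last Gram–Schmidt vector of a basis of the lattice is at most twice as long as the covering
radius. -/
theorem gsSq_last_le {d : ℕ} {ν : Fin d → ℚ} {b : Fin d → Fin d → ℚ} (hb : ∀ i, 0 < gsSq b i)
    (hL : iterLattice ν ≤ Submodule.span ℤ (Set.range fun i => toReal (b i))) {l : Fin d}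
    (hl : (l : ℕ) + 1 = d) :
    (gsSq b l : ℝ) ≤ (2 * coveringRadius (iterLattice ν)) ^ 2 := by
  set g : E d := toReal (gramSchmidt b l)
  have hgg : ‖g‖ ^ 2 = (gsSq b l : ℝ) := norm_toReal_sq _
  have hpos : (0 : ℝ) < gsSq b l := by exact_mod_cast hb l
  have hgpos : 0 < ‖g‖ := by
    refine (norm_nonneg g).lt_of_ne fun h => ?_
    rw [← hgg, ← h] at hpos
    norm_num at hpos
  -- The lattice lies in parallel hyperplanes orthogonal to g with spacing ‖g‖; the point g/2,
  -- halfway between two of them, is at distance at least ‖g‖/2 from the lattice.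
  have hint : ∀ x ∈ iterLattice ν, ∃ n : ℤ, inner ℝ x g = n * (gsSq b l : ℝ) := by
    intro x hx
    have hx' := hL hx
    clear hx
    induction hx' using Submodule.span_induction with
    | mem x hx =>
      obtain ⟨i, rfl⟩ := hx
      simp only [g, inner_toReal]
      by_cases hi : i = l
      · refine ⟨1, ?_⟩
        rw [hi, dotProduct_comm, dotProduct_gramSchmidt_basis_self, Int.cast_one, one_mul]
      · have hlt : i < l := by
          have : (i : ℕ) ≠ l := fun h => hi (Fin.ext h)
          rw [Fin.lt_def]; omega
        refine ⟨0, ?_⟩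
        rw [dotProduct_comm, dotProduct_gramSchmidt_basis_of_lt b hlt]
        simp
    | zero => exact ⟨0, by simp⟩
    | add x y _ _ hx hy =>
      obtain ⟨n, hn⟩ := hx; obtain ⟨m, hm⟩ := hy
      exact ⟨n + m, by rw [inner_add_left, hn, hm]; push_cast; ring⟩
    | smul c x _ hx =>
      obtain ⟨n, hn⟩ := hx
      refine ⟨c * n, ?_⟩
      rw [← Int.cast_smul_eq_zsmul ℝ, real_inner_smul_left, hn]; push_cast; ring
  have hle : ‖g‖ / 2 ≤ coveringRadius (iterLattice ν) := by
    rw [coveringRadius_eq]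
    refine le_csInf (coverRadii_nonempty ν) fun σ hσ => ?_
    obtain ⟨x, hx, hxσ⟩ := hσ.2 ((1 / 2 : ℝ) • g)
    obtain ⟨n, hn⟩ := hint x hx
    have h1 : inner ℝ ((1 / 2 : ℝ) • g - x) g = (1 / 2 - n) * ‖g‖ ^ 2 := by
      rw [inner_sub_left, real_inner_smul_left, real_inner_self_eq_norm_sq, hn, hgg]; ring
    have h2 := abs_real_inner_le_norm ((1 / 2 : ℝ) • g - x) g
    rw [h1, abs_mul, abs_of_nonneg (sq_nonneg ‖g‖)] at h2
    have h3 : (1 / 2 : ℝ) ≤ |1 / 2 - (n : ℝ)| := by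
      rcases le_or_gt n 0 with h | h
      · have : (n : ℝ) ≤ 0 := by exact_mod_cast h
        exact le_trans (by linarith) (le_abs_self _)
      · have : (1 : ℝ) ≤ n := by exact_mod_cast h
        exact le_trans (by linarith) (neg_le_abs _)
    have h4 : 1 / 2 * ‖g‖ ^ 2 ≤ σ * ‖g‖ :=
      (mul_le_mul_of_nonneg_right h3 (sq_nonneg _)).trans
        (h2.trans (mul_le_mul_of_nonneg_right hxσ hgpos.le))
    nlinarith
  rw [← hgg]
  exact pow_le_pow_left₀ hgpos.le (by linarith) 2

/-! ### The approximation factor -/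

theorem exists_int_of_mem_iterLattice {d q : ℕ} (hq : 0 < q) (p : Fin d → ℕ) {x : E d}
    (hx : x ∈ iterLattice (nuVec p q)) (k : Fin d) : ∃ z : ℤ, (q : ℝ) * x k = z := by
  have hqR : (q : ℝ) ≠ 0 := by exact_mod_cast hq.ne'
  rw [iterLattice, ← Submodule.span_union] at hx
  induction hx using Submodule.span_induction with
  | mem x hx =>
    rcases hx with ⟨i, rfl⟩ | rfl
    · by_cases hik : k = i
      · exact ⟨q, by simp [hik]⟩
      · exact ⟨0, by simp [hik]⟩
    · refine ⟨p k, ?_⟩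
      simp only [toReal, nuVec]
      push_cast
      field_simp
  | zero => exact ⟨0, by simp⟩
  | add x y _ _ hx hy =>
    obtain ⟨z, hz⟩ := hx; obtain ⟨w, hw⟩ := hy
    exact ⟨z + w, by rw [PiLp.add_apply, mul_add, hz, hw]; push_cast; rfl⟩
  | smul c x _ hx =>
    obtain ⟨z, hz⟩ := hx
    refine ⟨c * z, ?_⟩
    rw [PiLp.smul_apply, zsmul_eq_mul, mul_left_comm, hz]; push_cast; rfl

theorem one_le_mul_norm {d q : ℕ} (hq : 0 < q) (p : Fin d → ℕ) {y : E d}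
    (hy : y ≠ 0) (hyL : y ∈ iterLattice (nuVec p q)) : 1 ≤ (q : ℝ) * ‖y‖ := by
  have hqR : (0 : ℝ) < q := by exact_mod_cast hq
  obtain ⟨k, hk⟩ : ∃ k, y k ≠ 0 := by
    by_contra! h
    exact hy (PiLp.ext h)
  obtain ⟨z, hz⟩ := exists_int_of_mem_iterLattice hq p hyL k
  have hz0 : z ≠ 0 := by
    rintro rfl
    rw [Int.cast_zero] at hz
    exact (mul_ne_zero hqR.ne' hk) hz
  have h1 : (1 : ℝ) ≤ |(z : ℝ)| := by exact_mod_cast Int.one_le_abs hz0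
  rw [← hz, abs_mul, abs_of_pos hqR] at h1
  exact h1.trans (mul_le_mul_of_nonneg_left (PiLp.norm_apply_le y k) hqR.le)

/-- The minimum of the additive problem is the length of a nonzero lattice vector. -/
theorem exists_norm_eq_mAdd {d : ℕ} (hd : 0 < d) {p : Fin d → ℕ} {q : ℕ} (h : Admissible p q) :
    ∃ y ∈ iterLattice (nuVec p q), y ≠ 0 ∧ ‖y‖ = mAdd p q := by
  obtain ⟨t, -, -, -, ht⟩ := (isLeast_mAdd hd.ne' h).1
  set ν := nuVec p q with hν
  set x := modOne ((t : ℚ) • ν) with hx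
  set l : Fin d := ⟨d - 1, by omega⟩ with hl
  have hlast : ∀ i : Fin d, (i : ℕ) + 1 = d ↔ i = l := fun i => by
    rw [hl, Fin.ext_iff]; simp only; omega
  -- Up to the sign of the last coordinate, the flipped vector is x - e_d, which is in the lattice;
  -- its last coordinate is negative because fractional parts are below 1.
  set w : Fin d → ℚ := x - Pi.single l 1 with hw
  have hwl : w l < 0 := by
    have := Int.fract_lt_one (((t : ℚ) • ν) l)
    simp only [hw, hx, modOne, Pi.sub_apply, Pi.single_eq_same]
    linarith
  have habs : ∀ i, |flipLast x i| = |w i| := by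
    intro i
    simp only [flipLast, hlast]
    split_ifs with hi
    · rw [hi, hw, Pi.sub_apply, Pi.single_eq_same, abs_sub_comm]
    · rw [hw, Pi.sub_apply, Pi.single_eq_of_ne hi, sub_zero]
  refine ⟨toReal w, ?_, ?_, ?_⟩
  · have hsum : toReal w = (t : ℤ) • toReal ν +
        ∑ i, (-⌊((t : ℚ) • ν) i⌋ - if i = l then 1 else 0 : ℤ) •
          (EuclideanSpace.single i (1 : ℝ) : E d) := by
      ext k
      simp only [toReal, hw, hx, modOne, Int.fract, Pi.sub_apply, Pi.single_apply, PiLp.add_apply,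
        PiLp.smul_apply, Pi.smul_apply, WithLp.ofLp_sum, Finset.sum_apply, WithLp.ofLp_smul]
      rw [Finset.sum_eq_single k]
      · split_ifs <;> simp [-Int.self_sub_floor] <;> ring
      · intro i _ hik
        simp [Ne.symm hik]
      · simp
    rw [hsum]
    refine add_mem (Submodule.mem_sup_right (Submodule.smul_mem _ _
      (Submodule.mem_span_singleton_self _))) (Submodule.mem_sup_left (Submodule.sum_mem _
        fun i _ => Submodule.smul_mem _ _ (Submodule.subset_span ⟨i, rfl⟩)))
  · intro h0
    have h1 : (w l : ℝ) = 0 := congrArg (fun v : E d => v l) h0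
    exact hwl.ne (by exact_mod_cast h1)
  · rw [ht, N_eq]
    exact le_antisymm (norm_toReal_le_norm_toReal fun i => (habs i).ge)
      (norm_toReal_le_norm_toReal fun i => (habs i).le)

theorem linearIndependent_of_toReal {d : ℕ} {u : Fin d → Fin d → ℚ}
    (h : LinearIndependent ℝ fun i => toReal (u i)) : LinearIndependent ℚ u := by
  rw [Fintype.linearIndependent_iff] at h ⊢
  intro g hg i
  have h1 : ∑ i, (g i : ℝ) • toReal (u i) = 0 := by
    ext k
    have h2 := congrFun hg k
    simp only [Finset.sum_apply, Pi.smul_apply, smul_eq_mul, Pi.zero_apply] at h2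
    simp only [toReal, WithLp.ofLp_sum, Finset.sum_apply, PiLp.smul_apply, smul_eq_mul,
      PiLp.zero_apply]
    exact_mod_cast h2
  exact_mod_cast h (fun i => (g i : ℝ)) h1 i

theorem toReal_mem_span {d : ℕ} {b : Fin d → Fin d → ℚ} {x : Fin d → ℚ}
    (hx : x ∈ Submodule.span ℤ (Set.range b)) :
    toReal x ∈ Submodule.span ℤ (Set.range fun i => toReal (b i)) := by
  induction hx using Submodule.span_induction with
  | mem x hx => obtain ⟨i, rfl⟩ := hx; exact Submodule.subset_span ⟨i, rfl⟩
  | zero =>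
    have : toReal (0 : Fin d → ℚ) = 0 := by ext i; simp [toReal]
    rw [this]; exact zero_mem _
  | add x y _ _ hx hy => rw [toReal_add]; exact add_mem hx hy
  | smul c x _ hx => rw [toReal_zsmul]; exact Submodule.smul_mem _ _ hx

/-- The additive algorithm terminates, with an output of norm at most
`(1 + √d) √(2^d - 1) τ + √d ε`, where `ε` is the accuracy of the search. -/
theorem exists_mem_additiveAlgorithm {d : ℕ} (hd : 2 ≤ d) {p : Fin d → ℕ} {q : ℕ}
    (h : Admissible p q) {u : Fin d → Fin d → ℚ}
    (hu : IsLatticeBasis u (iterLattice (nuVec p q))) {δ : ℚ} (hδ : 0 < δ) :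
    ∃ ξ ∈ additiveAlgorithm (nuVec p q) u δ,
      N ξ ≤ (1 + Real.sqrt d) *
        (Real.sqrt (2 ^ d - 1) * coveringRadius (iterLattice (nuVec p q))) + δ := by
  obtain ⟨hq, hp, -⟩ := h
  set τ := coveringRadius (iterLattice (nuVec p q))
  have hτ : 0 ≤ τ := coveringRadius_nonneg _
  set l : Fin d := ⟨d - 1, by omega⟩
  have hl : (l : ℕ) + 1 = d := by simp only [l]; omega
  have hqQ : (0 : ℚ) < q := by exact_mod_cast hq
  have humem : ∀ i, toReal (u i) ∈ iterLattice (nuVec p q) := fun i => by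
    rw [← hu.2]; exact Submodule.subset_span ⟨i, rfl⟩
  obtain ⟨b, hb, hpos, hspan, hred⟩ := exists_mem_lll
    (gsSq_pos_of_linearIndependent (linearIndependent_of_toReal hu.1)) hq fun i k => by
      obtain ⟨z, hz⟩ := exists_int_of_mem_iterLattice hq p (humem i) k
      refine ⟨z, ?_⟩
      have hz' : (q : ℝ) * ((u i k : ℚ) : ℝ) = z := hz
      exact_mod_cast hz'
  have hL : iterLattice (nuVec p q) ≤ Submodule.span ℤ (Set.range fun i => toReal (b i)) := by
    rw [← hu.2, Submodule.span_le]
    rintro _ ⟨i, rfl⟩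
    exact toReal_mem_span (by rw [hspan]; exact Submodule.subset_span ⟨i, rfl⟩)
  have h2d : (1 : ℝ) ≤ 2 ^ d := one_le_pow₀ one_le_two
  have hρsq : (Real.sqrt (2 ^ d - 1) * τ) ^ 2 = (2 ^ d - 1) * τ ^ 2 := by
    rw [mul_pow, Real.sq_sqrt (by linarith)]
  have hbabai : ∀ c, ((dotProduct (c - nearestPlane b c) (c - nearestPlane b c) : ℚ) : ℝ) ≤
      (Real.sqrt (2 ^ d - 1) * τ) ^ 2 := by
    intro c
    have h1 := (dotProduct_sub_nearestPlane_le hpos c).trans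
      (mul_le_mul_of_nonneg_left (sum_gsSq_le hred hl) (by norm_num))
    have h2 : ((dotProduct (c - nearestPlane b c) (c - nearestPlane b c) : ℚ) : ℝ) ≤
        1 / 4 * ((2 ^ d - 1) * gsSq b l) := by
      refine ((Rat.cast_le (K := ℝ)).2 h1).trans_eq ?_
      push_cast
      rfl
    have h3 := mul_le_mul_of_nonneg_left (gsSq_last_le hpos hL hl) (sub_nonneg.2 h2d)
    rw [hρsq]
    linarith
  have hceil : (0 : ℚ) < (⌈Real.sqrt (d : ℝ)⌉₊ : ℚ) := by
    have : 0 < ⌈Real.sqrt (d : ℝ)⌉₊ :=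
      Nat.ceil_pos.2 (Real.sqrt_pos.2 (by exact_mod_cast (by omega : 0 < d)))
    exact_mod_cast this
  have hε : 0 < δ / (⌈Real.sqrt (d : ℝ)⌉₊ : ℚ) := div_pos hδ hceil
  obtain ⟨s, hs, h1, h2, h3, h4, h5⟩ := exists_mem_search (by positivity) hbabai hε
  have hν0 : ∀ i, 0 ≤ nuVec p q i := fun i => by unfold nuVec; positivity
  have hν1 : ∀ i, nuVec p q i ≤ 1 := fun i =>
    (div_le_one hqQ).2 (by exact_mod_cast (hp i).2.le)
  refine ⟨_, ?_, (N_output_le hd hν0 hν1 (by positivity) hε.le h1 h2 h3 h4 h5).trans ?_⟩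
  · exact Part.mem_map _ (Part.mem_bind hb (Part.mem_map SearchState.pt hs))
  · have hc : (0 : ℝ) < (⌈Real.sqrt (d : ℝ)⌉₊ : ℝ) := by exact_mod_cast hceil
    have hδ' : (0 : ℝ) < δ := by exact_mod_cast hδ
    -- Dividing the accuracy by ⌈√d⌉ absorbs the factor √d that comes from the norm of c(r) after
    -- flipping.
    have h6 : Real.sqrt d * ((δ / (⌈Real.sqrt (d : ℝ)⌉₊ : ℚ) : ℚ) : ℝ) ≤ δ := by
      push_cast
      rw [mul_div_assoc', div_le_iff₀ hc, mul_comm]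
      exact mul_le_mul_of_nonneg_left (Nat.le_ceil _) hδ'.le
    linarith

theorem exists_mem_additiveAlgorithm_ratio_lt {d : ℕ} (hd : 2 ≤ d) {p : Fin d → ℕ} {q : ℕ}
    (h : Admissible p q) {u : Fin d → Fin d → ℚ}
    (hu : IsLatticeBasis u (iterLattice (nuVec p q))) :
    ∃ ξ ∈ additiveAlgorithm (nuVec p q) u (1 / (q : ℚ)),
      N ξ / mAdd p q < (2 : ℝ) ^ (3 * (d : ℝ) / 2 - 1) * (1 + Real.sqrt (d : ℝ)) *
        coveringRadius (iterLattice (nuVec p q)) ^ d * (q : ℝ) + 1 := by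
  have hq : 0 < q := h.1
  have hqR : (0 : ℝ) < q := by exact_mod_cast hq
  obtain ⟨ξ, hξ, hN⟩ := exists_mem_additiveAlgorithm hd h hu
    (show (0 : ℚ) < 1 / (q : ℚ) by positivity)
  refine ⟨ξ, hξ, ?_⟩
  obtain ⟨y, hyL, hy0, hym⟩ := exists_norm_eq_mAdd (by omega) h
  set τ := coveringRadius (iterLattice (nuVec p q))
  have hm1 : 1 ≤ (q : ℝ) * ‖y‖ := one_le_mul_norm hq p hy0 hyL
  have hm2 : 1 ≤ (q : ℝ) * ‖y‖ * (2 * τ) ^ (d - 1) :=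
    one_le_mul_coveringRadius (by omega) hq p hy0 hyL
  have hy : 0 < ‖y‖ := norm_pos_iff.2 hy0
  -- As d - 1 ≥ 1, the value τ = 0 would contradict the volume bound. Positivity makes the step from
  -- 2^d - 1 to 2^d strict.
  have hτ : 0 < τ := by
    refine (coveringRadius_nonneg _).lt_of_ne fun h0 => ?_
    change 0 = τ at h0
    rw [← h0, mul_zero, zero_pow (by omega), mul_zero] at hm2
    norm_num at hm2
  have hsqrt : Real.sqrt (2 ^ d - 1) < Real.sqrt (2 ^ d) :=
    Real.sqrt_lt_sqrt (sub_nonneg.2 (one_le_pow₀ one_le_two)) (by linarith)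
  have hpow : (2 : ℝ) ^ (3 * (d : ℝ) / 2 - 1) = Real.sqrt (2 ^ d) * 2 ^ (d - 1) := by
    rw [Real.sqrt_eq_rpow, ← Real.rpow_natCast, ← Real.rpow_natCast, ← Real.rpow_mul zero_le_two,
      ← Real.rpow_add two_pos, Nat.cast_sub (by omega)]
    congr 1
    push_cast
    ring
  rw [← hym, div_lt_iff₀ hy, hpow]
  have hτd : τ ^ d = τ ^ (d - 1) * τ := by rw [← pow_succ]; congr 1; omega
  have hs : 0 < 1 + Real.sqrt (d : ℝ) := by positivity
  have h1 : (1 + Real.sqrt d) * (Real.sqrt (2 ^ d - 1) * τ) <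
      (1 + Real.sqrt d) * (Real.sqrt (2 ^ d) * τ) :=
    mul_lt_mul_of_pos_left (mul_lt_mul_of_pos_right hsqrt hτ) hs
  have h2 : (1 + Real.sqrt d) * (Real.sqrt (2 ^ d) * τ) ≤
      (1 + Real.sqrt d) * (Real.sqrt (2 ^ d) * τ) * ((q : ℝ) * ‖y‖ * (2 * τ) ^ (d - 1)) :=
    le_mul_of_one_le_right (by positivity) hm2
  have h3 : (((1 / (q : ℚ) : ℚ)) : ℝ) ≤ ‖y‖ := by
    push_cast
    rw [div_le_iff₀ hqR, mul_comm]
    exact hm1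
  calc N ξ ≤ _ := hN
    _ < (1 + Real.sqrt d) * (Real.sqrt (2 ^ d) * τ) * ((q : ℝ) * ‖y‖ * (2 * τ) ^ (d - 1)) + ‖y‖ := by
        linarith
    _ = _ := by rw [hτd, mul_pow]; ring

/-- With D = max(C, 1), one has τ^d q ≤ D^d and 1 + √d ≤ 2^d. The summand 1 is absorbed by doubling,
and the exponent of 2 totals 5d/2 ≤ 3d; taking the maximum with 1 keeps D^d ≥ 1. -/
theorem ratio_bound_le {C : ℝ} (hC : 0 < C) {d q : ℕ} (hd : 2 ≤ d) (hq : 0 < q) {τ : ℝ}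
    (hτ0 : 0 ≤ τ) (hτ : τ ≤ C * (q : ℝ) ^ (-(1 / (d : ℝ)))) :
    (2 : ℝ) ^ (3 * (d : ℝ) / 2 - 1) * (1 + Real.sqrt (d : ℝ)) * τ ^ d * (q : ℝ) + 1 ≤
      (2 : ℝ) ^ ((3 + Real.logb 2 (max C 1)) * (d : ℝ)) := by
  have hqR : (0 : ℝ) < q := by exact_mod_cast hq
  have hdR : (2 : ℝ) ≤ d := by exact_mod_cast hd
  set D := max C 1
  have hD1 : 1 ≤ D := le_max_right _ _
  have h1 : τ ^ d * q ≤ D ^ d := by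
    have h2 := pow_le_pow_left₀ hτ0 hτ d
    rw [mul_pow, ← Real.rpow_natCast ((q : ℝ) ^ (-(1 / (d : ℝ)))), ← Real.rpow_mul hqR.le,
      neg_mul, one_div_mul_cancel (by linarith), Real.rpow_neg_one] at h2
    calc τ ^ d * q ≤ C ^ d * (q : ℝ)⁻¹ * q := mul_le_mul_of_nonneg_right h2 hqR.le
      _ = C ^ d := by rw [mul_assoc, inv_mul_cancel₀ hqR.ne', mul_one]
      _ ≤ D ^ d := pow_le_pow_left₀ hC.le (le_max_left _ _) d
  have h3 : 1 + Real.sqrt (d : ℝ) ≤ 2 ^ (d : ℝ) := by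
    have h4 : Real.sqrt d ≤ d := Real.sqrt_le_iff.2 ⟨by linarith, by nlinarith⟩
    have h5 : (d : ℝ) + 1 ≤ 2 ^ d := by exact_mod_cast Nat.lt_two_pow_self (n := d)
    rw [Real.rpow_natCast]
    linarith
  have h6 : (2 : ℝ) ^ ((3 + Real.logb 2 D) * (d : ℝ)) = 2 ^ (3 * (d : ℝ)) * D ^ d := by
    rw [add_mul, Real.rpow_add two_pos, Real.rpow_mul zero_le_two (Real.logb 2 D),
      Real.rpow_logb two_pos (by norm_num) (by linarith), Real.rpow_natCast]
  have h7 : 1 ≤ D ^ d := one_le_pow₀ hD1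
  have h8 : (2 : ℝ) ^ (3 * (d : ℝ) / 2 - 1) * 2 ^ (d : ℝ) * 2 ≤ 2 ^ (3 * (d : ℝ)) := by
    rw [← Real.rpow_add two_pos]
    nth_rewrite 3 [← Real.rpow_one 2]
    rw [← Real.rpow_add two_pos]
    exact Real.rpow_le_rpow_of_exponent_le one_le_two (by linarith)
  set a := (2 : ℝ) ^ (3 * (d : ℝ) / 2 - 1)
  have ha : 1 ≤ a := Real.one_le_rpow one_le_two (by linarith)
  set e := (2 : ℝ) ^ (d : ℝ)
  have he : 1 ≤ e := Real.one_le_rpow one_le_two (by linarith)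
  rw [h6]
  calc a * (1 + Real.sqrt d) * τ ^ d * q + 1 = a * (1 + Real.sqrt d) * (τ ^ d * q) + 1 := by ring
    _ ≤ a * e * D ^ d + a * e * D ^ d := by
        refine add_le_add ?_ ?_
        · exact mul_le_mul (mul_le_mul_of_nonneg_left h3 (by linarith)) h1 (by positivity)
            (by positivity)
        · exact one_le_mul_of_one_le_of_one_le (one_le_mul_of_one_le_of_one_le ha he) h7
    _ = a * e * 2 * D ^ d := by ring
    _ ≤ _ := mul_le_mul_of_nonneg_right h8 (by positivity)

end CGCut

theorem mainTheorem5 :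
    (∀ (d : ℕ) (_ : 2 ≤ d) (p : Fin d → ℕ) (q : ℕ) (_ : CGCut.Admissible p q)
        (u : Fin d → Fin d → ℚ)
        (_ : CGCut.IsLatticeBasis u (CGCut.iterLattice (CGCut.nuVec p q))),
      ∃ ξ ∈ CGCut.additiveAlgorithm (CGCut.nuVec p q) u (1 / (q : ℚ)),
        CGCut.N ξ / CGCut.mAdd p q <
          (2 : ℝ) ^ (3 * (d : ℝ) / 2 - 1) * (1 + Real.sqrt (d : ℝ)) *
            CGCut.coveringRadius (CGCut.iterLattice (CGCut.nuVec p q)) ^ d * (q : ℝ) + 1) ∧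
    (∀ C : ℝ, 0 < C → ∃ K : ℝ, 0 < K ∧
      ∀ (d : ℕ) (_ : 2 ≤ d) (p : Fin d → ℕ) (q : ℕ) (_ : CGCut.Admissible p q)
        (u : Fin d → Fin d → ℚ)
        (_ : CGCut.IsLatticeBasis u (CGCut.iterLattice (CGCut.nuVec p q)))
        (_ : CGCut.coveringRadius (CGCut.iterLattice (CGCut.nuVec p q)) ≤
          C * (q : ℝ) ^ (-(1 / (d : ℝ)))),
      ∃ ξ ∈ CGCut.additiveAlgorithm (CGCut.nuVec p q) u (1 / (q : ℚ)),
        CGCut.N ξ / CGCut.mAdd p q < (2 : ℝ) ^ (K * (d : ℝ))) := by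
  refine ⟨fun d hd p q h u hu => CGCut.exists_mem_additiveAlgorithm_ratio_lt hd h hu,
    fun C hC => ⟨3 + Real.logb 2 (max C 1), ?_, fun d hd p q h u hu hτ => ?_⟩⟩
  · have := Real.logb_nonneg one_lt_two (le_max_right C 1)
    linarith
  · obtain ⟨ξ, hξ, hlt⟩ := CGCut.exists_mem_additiveAlgorithm_ratio_lt hd h hu
    exact ⟨ξ, hξ, hlt.trans_le
      (CGCut.ratio_bound_le hC hd h.1 (CGCut.coveringRadius_nonneg _) hτ)⟩
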